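/- Let $f:[0,\infty)\to\mathbb{R}$ be smooth and decreasing with $f(0)=\pi$ and $f(r)\to 0$ as $r\to\infty$, let $B>1$ be an integer, and put $f_B(r)=f(B^{-1/3}r)$. Let $R_B:S^2\to S^2$ be the map $(\theta,\phi)\mapsto(\theta,B\phi)$ in spherical polar coordinates, and let $\varphi_B:\mathbb{R}^3\to S^3$ be the axially symmetric suspension field $$\varphi_B(rn)=(\cos f_B(r),\ \sin f_B(r)\,R_B(n)),\qquad r\ge 0,\ n\in S^2 .$$ For an open set $U\subseteq\mathbb{R}^3$ let $\mathrm{SDiff}(U)$ be the group of volume preserving diffeomorphisms of $U$ with compact support, and let $E_2(\varphi)=\frac12\int_U|d\varphi|^2$. A map $\varphi:U\to S^3$ is called restricted harmonic if $E_2(\varphi)<\infty$ and $\frac{d}{dt}\big|_{t=0}E_2(\varphi\circ\psi_t)=0$ for all smooth curves $\psi_t$ in $\mathrm{SDiff}(U)$ with $\psi_0=\mathrm{id}$. (The field $\varphi_B$ is smooth off the $z$-axis $\mathbb{R}_z$ but has conical singularities along it; on $U=\mathbb{R}^3$ its differential is taken almost everywhere.) For a symmetric $(0,2)$ tensor $\alpha$,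 let $\operatorname{div}\alpha=\sum_i(\nabla_{e_i}\alpha)(e_i,\cdot)$, and let $h$ be the round metric of $S^3$. Then: 1. $\varphi_B$ is smooth on $\mathbb{R}^3\setminus\mathbb{R}_z$, and there $$\varphi_B^*h=f_B'(r)^2\,dr^2+\sin^2 f_B(r)\,\bigl(d\theta^2+B^2\sin^2\theta\,d\phi^2\bigr).$$ 2. There is a smooth function $p:(0,\infty)\to\mathbb{R}$ such that on $\mathbb{R}^3\setminus\mathbb{R}_z$ $$\operatorname{div}\varphi_B^*h=p(r)\,dr-(B^2-1)\,\frac{\sin^2 f_B(r)}{r^2}\,\cot\theta\,d\theta .$$ The one-form $(B^2-1)\sin^2 f_B(r)\,r^{-2}\cot\theta\,d\theta$ is not closed on $\mathbb{R}^3\setminus\mathbb{R}_z$, and neither is $\operatorname{div}\varphi_B^*h$. 3. $\varphi_B$ is not restricted harmonic, neither on $U=\mathbb{R}^3\setminus\mathbb{R}_z$ nor on $U=\mathbb{R}^3$. Moreover, if $E_2(\varphi_B)<\infty$, there is a smooth curve $\psi_t$ in $\mathrm{SDiff}(\mathbb{R}^3\setminus\mathbb{R}_z)$ with $\psi_0=\mathrm{id}$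 and $\frac{d}{dt}\big|_{t=0}E_2(\varphi_B\circ\psi_t)<0$, and there is $\psi\in\mathrm{SDiff}(\mathbb{R}^3)$ with $E_2(\varphi_B\circ\psi)<E_2(\varphi_B)$. -/

import Mathlib

open Real Set Filter Topology MeasureTheory
open scoped ENNReal Manifold ContDiff

noncomputable section

namespace Skyrme

/-- Physical space `ℝ³` with its Euclidean metric `g`. -/
abbrev E3 : Type := EuclideanSpace ℝ (Fin 3)

/-- The ambient space `ℝ⁴` of the target sphere. -/
abbrev E4 : Type := EuclideanSpace ℝ (Fin 4)

/-- The unit sphere `S² ⊆ ℝ³`. -/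
abbrev S2 : Type := Metric.sphere (0 : E3) 1

/-- The unit sphere `S³ ⊆ ℝ⁴`; its round metric `h` is the one induced by `ℝ⁴`. -/
abbrev S3 : Type := Metric.sphere (0 : E4) 1

instance factFinrankE4 : Fact (Module.finrank ℝ E4 = 3 + 1) := ⟨by simp⟩

/-- The standard orthonormal frame of `ℝ³`. -/
def frame (i : Fin 3) : E3 := EuclideanSpace.single i 1

/-- Symmetric `(0,2)`-tensor fields on (subsets of) `ℝ³` are regarded as functions of this type. -/
abbrev Tensor2 : Type := E3 → E3 →L[ℝ] E3 →L[ℝ] ℝ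

/-- One-forms on (subsets of) `ℝ³`. -/
abbrev OneForm : Type := E3 → E3 →L[ℝ] ℝ

/-- The pullback `φ^*h` of the round metric of `S³`:
`(φ^*h)_x(u, v) = ⟪dφ_x u, dφ_x v⟫`. -/
def pullbackMetric (φ : E3 → S3) : Tensor2 := fun x =>
  (innerSL ℝ : E4 →L[ℝ] E4 →L[ℝ] ℝ).bilinearComp
    (fderiv ℝ (fun y => (φ y : E4)) x) (fderiv ℝ (fun y => (φ y : E4)) x)

/-- The divergence `(div α)(v) = ∑ᵢ (∇_{eᵢ} α)(eᵢ, v)` of a symmetric `(0,2)`-tensor field; in the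
standard frame of `ℝ³` the Levi-Civita connexion is componentwise differentiation. -/
def divergence (α : Tensor2) : OneForm := fun x =>
  ∑ i : Fin 3, (fderiv ℝ α x (frame i)) (frame i)

/-- The exterior derivative of a one-form. -/
def extDerivOneForm (ν : OneForm) : E3 → E3 [⋀^Fin (1 + 1)]→L[ℝ] ℝ :=
  extDeriv (fun x => ContinuousAlternatingMap.ofSubsingleton ℝ E3 ℝ (0 : Fin 1) (ν x))

/-- A one-form is closed on `U`. -/
def IsClosedFormOn (U : Set E3) (ν : OneForm) : Prop := ∀ x ∈ U, extDerivOneForm ν x = 0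

/-- The Dirichlet energy `E₂(φ) = ½ ∫_U |dφ|²` over an open set `U ⊆ ℝ³`. It is meaningful for
smooth maps on `U`, and more generally for locally Lipschitz maps, whose differential exists almost
everywhere. -/
def dirichletEnergy (U : Set E3) (φ : E3 → S3) : ℝ≥0∞ :=
  ∫⁻ x in U, ENNReal.ofReal ((1 / 2) * ∑ i : Fin 3, pullbackMetric φ x (frame i) (frame i))

/-- `ψ ∈ SDiff(U)`: a volume preserving diffeomorphism whose support, the closure of
`{x | ψ x ≠ x}`, is a compact subset of the open set `U ⊆ ℝ³`. Such diffeomorphisms of `U` are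
extended by the identity to `ℝ³`. -/
structure IsSDiff (U : Set E3) (ψ : E3 → E3) : Prop where
  diffeo : ∃ Ψ : Diffeomorph 𝓘(ℝ, E3) 𝓘(ℝ, E3) E3 E3 ∞, ∀ x, Ψ x = ψ x
  volumePreserving : ∀ x, (fderiv ℝ ψ x).det = 1
  compactSupport : IsCompact (closure {x | ψ x ≠ x})
  support_subset : closure {x | ψ x ≠ x} ⊆ U

/-- A smooth curve `t ↦ ψ t` in `SDiff(U)` through `ψ 0 = id`: jointly smooth in `(t, x)`, with
supports contained in a common compact set for `t` in a bounded interval. -/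
structure IsSDiffCurve (U : Set E3) (ψ : ℝ → E3 → E3) : Prop where
  mem : ∀ t, IsSDiff U (ψ t)
  zero : ∀ x, ψ 0 x = x
  smooth : ContDiff ℝ ∞ (fun p : ℝ × E3 => ψ p.1 p.2)
  support : ∀ T : ℝ, ∃ K : Set E3, IsCompact K ∧ K ⊆ U ∧
    ∀ t ∈ Icc (-T) T, ∀ x ∉ K, ψ t x = x

/-- `φ : U → S³` is restricted harmonic: `E₂(φ)` is finite and the derivative at `t = 0` of
`E₂(φ ∘ ψ_t)` vanishes for all smooth curves `ψ_t` in `SDiff(U)` through the identity.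
No smoothness is built in, so that the notion applies both on an open set where `φ` is
smooth and on all of `ℝ³`, where `φ` may be merely locally Lipschitz. -/
def IsRestrictedHarmonicOn (U : Set E3) (φ : E3 → S3) : Prop :=
  dirichletEnergy U φ ≠ ⊤ ∧
    ∀ ψ : ℝ → E3 → E3, IsSDiffCurve U ψ →
      HasDerivAt (fun t => (dirichletEnergy U (φ ∘ ψ t)).toReal) 0 0

/-- The polar angle `θ ∈ [0, π]` of a point of `ℝ³`. -/
def polarAngle (x : E3) : ℝ := arccos (x 2 / ‖x‖)

/-- The azimuthal angle `ϕ ∈ (-π, π]` of a point of `ℝ³`. -/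
def azimuth (x : E3) : ℝ := Complex.arg ⟨x 0, x 1⟩

/-- `ℝ³` without the `z`-axis. -/
def offAxis : Set E3 := {x | x 0 ≠ 0 ∨ x 1 ≠ 0}

/-- The one-form `dr`. -/
def formDr : OneForm := fun x => fderiv ℝ (fun y : E3 => ‖y‖) x

/-- The one-form `dθ`. -/
def formDtheta : OneForm := fun x => fderiv ℝ polarAngle x

/-- The one-form `dϕ = (x₁ dx₂ - x₂ dx₁) / (x₁² + x₂²)`, smooth across the branch cut of the
azimuthal angle. -/
def formDphi : OneForm := fun x =>
  ((x 0) ^ 2 + (x 1) ^ 2)⁻¹ •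
    (x 0 • (EuclideanSpace.proj 1 : E3 →L[ℝ] ℝ) - x 1 • (EuclideanSpace.proj 0 : E3 →L[ℝ] ℝ))

/-- The map `(θ, ϕ) ↦ (θ, B ϕ)` of `S²` to itself, in terms of the angles of a point; only its
restriction to the unit sphere matters. -/
def angularMap (B : ℕ) (n : E3) : S2 :=
  ⟨!₂[sin (polarAngle n) * cos (B * azimuth n), sin (polarAngle n) * sin (B * azimuth n),
      cos (polarAngle n)], by
    rw [mem_sphere_zero_iff_norm, EuclideanSpace.norm_eq, Real.sqrt_eq_one]
    simp only [Fin.sum_univ_three, Real.norm_eq_abs, sq_abs]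
    simp
    nlinarith [sin_sq_add_cos_sq (polarAngle n), sin_sq_add_cos_sq (B * azimuth n)]⟩

/-- The suspension `φ(r n) = (cos F(r), sin F(r) R(n))` of `R` by the profile function `F`, where
`r ≥ 0` and `|n| = 1`. (If `sin F(0) = 0`, the value at the origin does not depend on `R`.) -/
def suspension (R : E3 → S2) (F : ℝ → ℝ) (x : E3) : S3 :=
  ⟨!₂[cos (F ‖x‖), sin (F ‖x‖) * (R (‖x‖⁻¹ • x) : E3) 0,
      sin (F ‖x‖) * (R (‖x‖⁻¹ • x) : E3) 1, sin (F ‖x‖) * (R (‖x‖⁻¹ • x) : E3) 2], by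
    have h := mem_sphere_zero_iff_norm.1 (R (‖x‖⁻¹ • x)).2
    rw [EuclideanSpace.norm_eq, Real.sqrt_eq_one] at h
    simp only [Fin.sum_univ_three, Real.norm_eq_abs, sq_abs] at h
    rw [mem_sphere_zero_iff_norm, EuclideanSpace.norm_eq, Real.sqrt_eq_one]
    simp only [Fin.sum_univ_four, Real.norm_eq_abs, sq_abs]
    simp
    linear_combination sin_sq_add_cos_sq (F ‖x‖) + (sin (F ‖x‖)) ^ 2 * h⟩

/-- The rescaled profile function `f_B(r) = f(B^{-1/3} r)`. -/
def scaledProfile (f : ℝ → ℝ) (B : ℕ) (r : ℝ) : ℝ := f ((B : ℝ) ^ (-(1 / 3) : ℝ) * r)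

/-- The axially symmetric field `φ_B(r n) = (cos f_B(r), sin f_B(r) R_B(n))`. -/
def axialField (f : ℝ → ℝ) (B : ℕ) : E3 → S3 := suspension (angularMap B) (scaledProfile f B)

end Skyrme

end

/-! ### Twists: explicit volume preserving diffeomorphisms -/

namespace Skyrme


/-! Write `α` for the pullback metric; the energy density is half its trace. Along a divergence free
field `X` the first variation of the energy is the integral of `½ tr ∇_X α + ∑ α(∇_{e_i} X, e_i)`.
If `X = ∂_a η e_b - ∂_b η e_a` with `η` a test function, the first term is a Poisson bracket and
integrates to zero, and integrating the second by parts twice leaves `∫ d(div α)(e_a, e_b) η`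
(`integral_variation_hamField`). So if `div α` is not closed at a point of an open set where the
field is smooth, a nonnegative bump `η` near that point, with the pair `(a, b)` ordered to give the
right sign, makes the energy decrease to first order (`exists_curve_energy_decreasing`).

No flow has to be constructed: for `η` a function of `|x - c|²`, `X` rotates each sphere about `c`
rigidly, and its flow is the explicit `twist`. As it is supported in a ball off the axis, the
conical singularities play no role there.

For the suspension field, `α` is a radially symmetric tensor plus `(B² - 1) b(r) τ ⊗ τ / ρ²`, where
`b = sin² F / r²`, `τ = x₀ dx₁ - x₁ dx₀` and `ρ` is the distance to the axis. Its divergence is a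
radial form minus `(B² - 1) b(r) d log ρ` (`divergence_suspension_cartesian`), with exterior
derivative `-(B² - 1) b'(r) dr ∧ d log ρ`. If this vanished, `b` would be constant; it tends to zero
at infinity, so `sin F` would vanish identically, whereas `F` falls from `π` to `0`
(`deriv_eq_zero_of_isClosedFormOn`, `exists_deriv_angularCoeff_ne_zero`). -/

/-- The generator `y ↦ y_a e_b - y_b e_a` of the rotations in the coordinate plane `(a, b)`. -/
noncomputable def rotGen (a b : Fin 3) : E3 →L[ℝ] E3 :=
  (EuclideanSpace.proj a : E3 →L[ℝ] ℝ).smulRight (frame b) -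
    (EuclideanSpace.proj b : E3 →L[ℝ] ℝ).smulRight (frame a)

/-- The orthogonal projection to the coordinate plane `(a, b)`. -/
noncomputable def planeProj (a b : Fin 3) : E3 →L[ℝ] E3 :=
  (EuclideanSpace.proj a : E3 →L[ℝ] ℝ).smulRight (frame a) +
    (EuclideanSpace.proj b : E3 →L[ℝ] ℝ).smulRight (frame b)

/-- The twist about `c`: the sphere of radius `ρ` about `c` is rotated in the coordinate plane
`(a, b)` by the angle `t χ(ρ²)`. -/
noncomputable def twist (c : E3) (a b : Fin 3) (χ : ℝ → ℝ) (t : ℝ) (x : E3) : E3 :=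
  x + (cos (t * χ (‖x - c‖ ^ 2)) - 1) • planeProj a b (x - c) +
    sin (t * χ (‖x - c‖ ^ 2)) • rotGen a b (x - c)

variable {c : E3} {a b : Fin 3} {χ : ℝ → ℝ}

theorem norm_twist_sub (hab : a ≠ b) (t : ℝ) (x : E3) : ‖twist c a b χ t x - c‖ = ‖x - c‖ := by
  rw [← sq_eq_sq₀ (norm_nonneg _) (norm_nonneg _)]
  unfold twist
  generalize t * χ (‖x - c‖ ^ 2) = s
  have h := sin_sq_add_cos_sq s
  simp only [EuclideanSpace.real_norm_sq_eq, Fin.sum_univ_three, planeProj, rotGen, frame]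
  fin_cases a <;> fin_cases b <;> first | exact absurd rfl hab | skip
  all_goals
    simp
    first
    | linear_combination ((x 0 - c 0) ^ 2 + (x 1 - c 1) ^ 2) * h
    | linear_combination ((x 0 - c 0) ^ 2 + (x 2 - c 2) ^ 2) * h
    | linear_combination ((x 1 - c 1) ^ 2 + (x 2 - c 2) ^ 2) * h

/-- The angle depends only on the distance to `c`, which the twist preserves, so a point and its
image are rotated by opposite angles. -/
theorem twist_neg_twist (hab : a ≠ b) (t : ℝ) (x : E3) :
    twist c a b χ (-t) (twist c a b χ t x) = x := by
  have hn := norm_twist_sub (c := c) (χ := χ) hab t x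
  rw [twist, hn]
  unfold twist
  rw [neg_mul]
  generalize t * χ (‖x - c‖ ^ 2) = s
  have h := sin_sq_add_cos_sq s
  rw [cos_neg, sin_neg]
  ext i
  simp only [planeProj, rotGen, frame]
  fin_cases a <;> fin_cases b <;> first | exact absurd rfl hab | skip
  all_goals
    fin_cases i <;> simp <;> first
    | ring1
    | linear_combination (x 0 - c 0) * h
    | linear_combination (x 1 - c 1) * h
    | linear_combination (x 2 - c 2) * h

theorem contDiff_twist (hχ : ContDiff ℝ ∞ χ) :
    ContDiff ℝ ∞ (fun p : ℝ × E3 => twist c a b χ p.1 p.2) := by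
  unfold twist
  have h : ContDiff ℝ ∞ (fun p : ℝ × E3 => p.1 * χ (‖p.2 - c‖ ^ 2)) :=
    contDiff_fst.mul (hχ.comp ((contDiff_snd.sub contDiff_const).norm_sq ℝ))
  have h1 : ContDiff ℝ ∞ (fun p : ℝ × E3 => p.2 - c) := contDiff_snd.sub contDiff_const
  exact (contDiff_snd.add ((h.cos.sub contDiff_const).smul
    ((planeProj a b).contDiff.comp h1))).add (h.sin.smul ((rotGen a b).contDiff.comp h1))

theorem hasFDerivAt_twist (hχ : ContDiff ℝ ∞ χ) (t : ℝ) (x : E3) :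
    HasFDerivAt (twist c a b χ t)
      (ContinuousLinearMap.id ℝ E3 + (cos (t * χ (‖x - c‖ ^ 2)) - 1) • planeProj a b +
        sin (t * χ (‖x - c‖ ^ 2)) • rotGen a b +
        (innerSL ℝ (x - c)).smulRight ((2 * t * deriv χ (‖x - c‖ ^ 2)) •
          (cos (t * χ (‖x - c‖ ^ 2)) • rotGen a b (x - c) -
            sin (t * χ (‖x - c‖ ^ 2)) • planeProj a b (x - c)))) x := by
  have h1 : HasFDerivAt (fun y : E3 => y - c) (ContinuousLinearMap.id ℝ E3) x :=
    (hasFDerivAt_id x).sub_const c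
  have h2 : HasFDerivAt (fun y : E3 => t * χ (‖y - c‖ ^ 2))
      (t • (deriv χ (‖x - c‖ ^ 2) • (2 • (innerSL ℝ (x - c))))) x := by
    have h3 : HasFDerivAt (fun y : E3 => ‖y - c‖ ^ 2) (2 • (innerSL ℝ (x - c))) x := by
      simpa using h1.norm_sq
    have h4 := (hχ.differentiable (by simp)).differentiableAt.hasDerivAt (x := ‖x - c‖ ^ 2)
    exact (h4.comp_hasFDerivAt x h3).const_mul t
  have h5 := ((hasFDerivAt_id x).add ((h2.cos.sub_const 1).smul
    ((planeProj a b).hasFDerivAt.comp x h1))).add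
      (h2.sin.smul ((rotGen a b).hasFDerivAt.comp x h1))
  refine h5.congr_fderiv ?_
  ext v : 1
  simp
  module

/-- With `R` the rotation, `J` its generator and `y = x - c`, the derivative is `R (1 + d Jy ⊗ y)`.
Its determinant is `1 + d ⟪y, Jy⟫ = 1`, as `J` is skew; in coordinates only `sin² + cos² = 1` is
needed. -/
theorem det_fderiv_twist (hab : a ≠ b) (hχ : ContDiff ℝ ∞ χ) (t : ℝ) (x : E3) :
    (fderiv ℝ (twist c a b χ t) x).det = 1 := by
  rw [(hasFDerivAt_twist hχ t x).fderiv]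
  generalize t * χ (‖x - c‖ ^ 2) = s
  generalize 2 * t * deriv χ (‖x - c‖ ^ 2) = d
  generalize x - c = y
  have h := sin_sq_add_cos_sq s
  rw [ContinuousLinearMap.det, ← LinearMap.det_toMatrix (EuclideanSpace.basisFun (Fin 3) ℝ).toBasis,
    Matrix.det_fin_three]
  simp only [LinearMap.toMatrix_apply, planeProj, rotGen, frame]
  fin_cases a <;> fin_cases b <;> first | exact absurd rfl hab | skip
  all_goals
    simp [EuclideanSpace.inner_single_right]
    linear_combination h

theorem twist_eq_self {ε : ℝ} (hε : 0 ≤ ε) (hχ : ∀ s, ε ^ 2 ≤ s → χ s = 0) (t : ℝ) {x : E3}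
    (hx : x ∉ Metric.ball c ε) : twist c a b χ t x = x := by
  rw [mem_ball_iff_norm, not_lt] at hx
  simp [twist, hχ _ (pow_le_pow_left₀ hε hx 2)]

theorem twist_zero (x : E3) : twist c a b χ 0 x = x := by
  simp [twist]

theorem isSDiffCurve_twist {U : Set E3} {ε : ℝ} (hab : a ≠ b) (hχ : ContDiff ℝ ∞ χ) (hε : 0 ≤ ε)
    (hχ0 : ∀ s, ε ^ 2 ≤ s → χ s = 0) (hU : Metric.closedBall c ε ⊆ U) :
    IsSDiffCurve U (twist c a b χ) := by
  have hsm (t : ℝ) : ContDiff ℝ ∞ (twist c a b χ t) :=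
    (contDiff_twist hχ).comp (contDiff_const.prodMk contDiff_id)
  have hfix (t : ℝ) : ∀ x ∉ Metric.closedBall c ε, twist c a b χ t x = x := fun x hx =>
    twist_eq_self hε hχ0 t fun h => hx (Metric.ball_subset_closedBall h)
  have hsub (t : ℝ) : closure {x | twist c a b χ t x ≠ x} ⊆ Metric.closedBall c ε :=
    closure_minimal (fun x hx => by_contra fun h => hx (hfix t x h)) Metric.isClosed_closedBall
  refine ⟨fun t => ⟨⟨⟨⟨twist c a b χ t, twist c a b χ (-t), twist_neg_twist hab t, fun x => ?_⟩,
    (hsm t).contMDiff, (hsm (-t)).contMDiff⟩, fun x => rfl⟩, det_fderiv_twist hab hχ t,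
    (isCompact_closedBall c ε).of_isClosed_subset isClosed_closure (hsub t),
    (hsub t).trans hU⟩, twist_zero, contDiff_twist hχ,
    fun T => ⟨_, isCompact_closedBall c ε, hU, fun t _ => hfix t⟩⟩
  simpa using twist_neg_twist (c := c) (χ := χ) hab (-t) x

end Skyrme

/-! ### Integration by parts against test functions -/

namespace Skyrme


section IntegrationByParts

variable {V : Set E3} {g ζ : E3 → ℝ}

theorem integrable_mul_of_tsupport_subset (hV : IsOpen V) (hg : ContinuousOn g V)
    (hζ : Continuous ζ) (hc : HasCompactSupport ζ) (hζV : tsupport ζ ⊆ V) :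
    Integrable (fun x => g x * ζ x) := by
  refine Continuous.integrable_of_hasCompactSupport ?_ hc.mul_left
  refine (hg.mul hζ.continuousOn).continuous_of_tsupport_subset hV ?_
  exact (closure_mono (Function.support_mul_subset_right g ζ)).trans hζV

/-- Integration by parts against a test function supported where the other factor is smooth. -/
theorem integral_mul_fderiv_test (hV : IsOpen V) (hg : ContDiffOn ℝ ∞ g V) (hζ : ContDiff ℝ ∞ ζ)
    (hc : HasCompactSupport ζ) (hζV : tsupport ζ ⊆ V) (v : E3) :
    ∫ x, g x * fderiv ℝ ζ x v = -∫ x, fderiv ℝ g x v * ζ x := by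
  have hζ' : Continuous fun x => fderiv ℝ ζ x v :=
    (hζ.continuous_fderiv (by simp)).clm_apply continuous_const
  have hg' : ContinuousOn (fun x => fderiv ℝ g x v) V :=
    (hg.continuousOn_fderiv_of_isOpen hV (by simp)).clm_apply continuousOn_const
  refine integral_mul_fderiv_eq_neg_fderiv_mul_of_integrable
    (integrable_mul_of_tsupport_subset hV hg' hζ.continuous hc hζV)
    (integrable_mul_of_tsupport_subset hV hg.continuousOn hζ' (hc.fderiv_apply ℝ v)
      ((tsupport_fderiv_apply_subset ℝ v).trans hζV))
    (integrable_mul_of_tsupport_subset hV hg.continuousOn hζ.continuous hc hζV)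
    (fun x hx => ((hg.contDiffAt (hV.mem_nhds (hζV hx))).differentiableAt (by simp)))
    (fun x _ => (hζ.differentiable (by simp)) x)

theorem fderiv_fderiv_apply_comm (hζ : ContDiff ℝ ∞ ζ) (u v x : E3) :
    fderiv ℝ (fun y => fderiv ℝ ζ y u) x v = fderiv ℝ (fun y => fderiv ℝ ζ y v) x u := by
  have h : DifferentiableAt ℝ (fderiv ℝ ζ) x :=
    ((hζ.fderiv_right (m := ∞) (by simp)).differentiable (by simp)) x
  have hs : IsSymmSndFDerivAt ℝ ζ x := hζ.contDiffAt.isSymmSndFDerivAt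
    (by rw [minSmoothness_of_isRCLikeNormedField]; exact ENat.LEInfty.out)
  rw [fderiv_clm_apply h (by fun_prop), fderiv_clm_apply h (by fun_prop)]
  simpa using (hs v u)

/-- Poisson brackets with a test function integrate to zero. -/
theorem integral_fderiv_mul_fderiv_comm (hV : IsOpen V) (hg : ContDiffOn ℝ ∞ g V)
    (hζ : ContDiff ℝ ∞ ζ) (hc : HasCompactSupport ζ) (hζV : tsupport ζ ⊆ V) (u v : E3) :
    ∫ x, fderiv ℝ g x u * fderiv ℝ ζ x v = ∫ x, fderiv ℝ g x v * fderiv ℝ ζ x u := by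
  -- Both sides become `-∫ g ∂_u ∂_v ζ`, which is symmetric in `u` and `v`.
  have key (u v : E3) : ∫ x, fderiv ℝ g x u * fderiv ℝ ζ x v =
      -∫ x, g x * fderiv ℝ (fun y => fderiv ℝ ζ y v) x u := by
    rw [integral_mul_fderiv_test hV hg ((hζ.fderiv_right (m := ∞) (by simp)).clm_apply
      contDiff_const) (hc.fderiv_apply ℝ v) ((tsupport_fderiv_apply_subset ℝ v).trans hζV), neg_neg]
  rw [key, key]
  simp_rw [fderiv_fderiv_apply_comm hζ v u]

/-- Separates the first variation: `P - Q` stands for the Poisson bracket of a diagonal entry of `α`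
with `η` and drops out; `R - S` holds the second derivatives of `η`. -/
theorem integral_sum_sub_add_sub {P Q R S : Fin 3 → E3 → ℝ} (hP : ∀ i, Integrable (P i))
    (hQ : ∀ i, Integrable (Q i)) (hR : ∀ i, Integrable (R i)) (hS : ∀ i, Integrable (S i))
    (hPQ : ∀ i, ∫ x, P i x = ∫ x, Q i x) :
    ∫ x, ∑ i : Fin 3, ((1 / 2) * (P i x - Q i x) + (R i x - S i x)) =
      ∑ i : Fin 3, (∫ x, R i x) - ∑ i : Fin 3, ∫ x, S i x := by
  have h1 (i : Fin 3) : Integrable fun x => (1 / 2) * (P i x - Q i x) :=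
    ((hP i).sub (hQ i)).const_mul _
  have h2 (i : Fin 3) : Integrable fun x => R i x - S i x := (hR i).sub (hS i)
  have h3 (i : Fin 3) : Integrable fun x => (1 / 2) * (P i x - Q i x) + (R i x - S i x) :=
    (h1 i).add (h2 i)
  rw [integral_finsetSum _ fun i _ => h3 i, ← Finset.sum_sub_distrib]
  refine Finset.sum_congr rfl fun i _ => ?_
  rw [integral_add (h1 i) (h2 i), integral_const_mul, integral_sub (hP i) (hQ i),
    integral_sub (hR i) (hS i), hPQ]
  ring

end IntegrationByParts

/-! ### First variation along a Hamiltonian field -/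

/-- The divergence free field `∂_a η e_b - ∂_b η e_a`. -/
noncomputable def hamField (η : E3 → ℝ) (a b : Fin 3) (x : E3) : E3 :=
  fderiv ℝ η x (frame a) • frame b - fderiv ℝ η x (frame b) • frame a

theorem fderiv_apply_apply {α : Tensor2} {x : E3} (h : DifferentiableAt ℝ α x) (u v w : E3) :
    fderiv ℝ α x u v w = fderiv ℝ (fun y => α y v w) x u := by
  have h1 : HasFDerivAt (fun y => α y v w) _ x :=
    (h.hasFDerivAt.clm_apply (hasFDerivAt_const v x)).clm_apply (hasFDerivAt_const w x)
  rw [h1.fderiv]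
  simp

theorem contDiffOn_divergence {α : Tensor2} {V : Set E3} (hV : IsOpen V)
    (hα : ContDiffOn ℝ ∞ α V) : ContDiffOn ℝ ∞ (divergence α) V := by
  unfold divergence
  exact ContDiffOn.sum fun i _ => ((hα.fderiv_of_isOpen hV (by simp)).clm_apply
    contDiffOn_const).clm_apply contDiffOn_const

/-- The integrated first variation of `½ tr α` along a Hamiltonian field is the integral of the
exterior derivative of `div α` against the Hamiltonian. -/
theorem integral_variation_hamField {α : Tensor2} {V : Set E3} (hV : IsOpen V)
    (hα : ContDiffOn ℝ ∞ α V) (hsymm : ∀ x u v, α x u v = α x v u) {η : E3 → ℝ}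
    (hη : ContDiff ℝ ∞ η) (hc : HasCompactSupport η) (hηV : tsupport η ⊆ V) (a b : Fin 3) :
    ∫ x, ∑ i : Fin 3, ((1 / 2) * fderiv ℝ α x (hamField η a b x) (frame i) (frame i) +
        α x (fderiv ℝ (hamField η a b) x (frame i)) (frame i)) =
      ∫ x, (fderiv ℝ (divergence α) x (frame a) (frame b) -
        fderiv ℝ (divergence α) x (frame b) (frame a)) * η x := by
  have hαd : ∀ x ∈ V, DifferentiableAt ℝ α x := fun x hx =>
    (hα.contDiffAt (hV.mem_nhds hx)).differentiableAt (by simp)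
  have hαc (u v : E3) : ContDiffOn ℝ ∞ (fun x => α x u v) V :=
    (hα.clm_apply contDiffOn_const).clm_apply contDiffOn_const
  have hω (v : E3) : ContDiffOn ℝ ∞ (fun x => divergence α x v) V :=
    (contDiffOn_divergence hV hα).clm_apply contDiffOn_const
  have hηd (v : E3) : ContDiff ℝ ∞ fun x => fderiv ℝ η x v :=
    (hη.fderiv_right (m := ∞) (by simp)).clm_apply contDiff_const
  have hηs (v : E3) : tsupport (fun x => fderiv ℝ η x v) ⊆ V :=
    (tsupport_fderiv_apply_subset ℝ v).trans hηV
  have hηdd (u v : E3) : Continuous fun x => fderiv ℝ (fun y => fderiv ℝ η y u) x v :=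
    ((hηd u).continuous_fderiv (by simp)).clm_apply continuous_const
  have hηss (u v : E3) : tsupport (fun x => fderiv ℝ (fun y => fderiv ℝ η y u) x v) ⊆ V :=
    (tsupport_fderiv_apply_subset ℝ v).trans (hηs u)
  have hαf (u v w : E3) : ContinuousOn (fun x => fderiv ℝ (fun y => α y u v) x w) V :=
    ((hαc u v).continuousOn_fderiv_of_isOpen hV (by simp)).clm_apply continuousOn_const
  have hωf (u v : E3) : ContinuousOn (fun x => fderiv ℝ (fun y => divergence α y u) x v) V :=
    ((hω u).continuousOn_fderiv_of_isOpen hV (by simp)).clm_apply continuousOn_const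
  have hout : ∀ x ∉ V, η x = 0 := fun x hx => image_eq_zero_of_notMem_tsupport fun h => hx (hηV h)
  have hout1 (v : E3) : ∀ x ∉ V, fderiv ℝ η x v = 0 := fun x hx =>
    image_eq_zero_of_notMem_tsupport (f := fun x => fderiv ℝ η x v) fun h => hx (hηs v h)
  have hXd (x v : E3) : fderiv ℝ (hamField η a b) x v =
      fderiv ℝ (fun y => fderiv ℝ η y (frame a)) x v • frame b -
        fderiv ℝ (fun y => fderiv ℝ η y (frame b)) x v • frame a := by
    have h (w : E3) := ((hηd w).differentiable (by simp) x).hasFDerivAt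
    have h1 : HasFDerivAt (hamField η a b) _ x :=
      ((h (frame a)).smul (hasFDerivAt_const (frame b) x)).sub
        ((h (frame b)).smul (hasFDerivAt_const (frame a) x))
    rw [h1.fderiv]
    simp
  have htr (i : Fin 3) (u v : E3) := integrable_mul_of_tsupport_subset hV
    (hαf (frame i) (frame i) u) (hηd v).continuous (hc.fderiv_apply ℝ v) (hηs v)
  have hst (i : Fin 3) (u v : E3) := integrable_mul_of_tsupport_subset hV
    (hαc u (frame i)).continuousOn (hηdd v (frame i))
    ((hc.fderiv_apply ℝ v).fderiv_apply ℝ (frame i)) (hηss v (frame i))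
  have hdiv (i : Fin 3) (u v : E3) := integrable_mul_of_tsupport_subset hV
    (hαf u (frame i) (frame i)) (hηd v).continuous (hc.fderiv_apply ℝ v) (hηs v)
  have hint (u v : E3) := integrable_mul_of_tsupport_subset hV
    (hωf u v) hη.continuous hc hηV
  -- The first integration by parts moves `∂_i` onto `α(u, e_i)`, and the sum over `i` is `div α
  -- (u)` by symmetry of `α`; the second moves `∂_v` off `η`.
  have hpart (u v : E3) : ∑ i : Fin 3, ∫ x, α x u (frame i) *
      fderiv ℝ (fun y => fderiv ℝ η y v) x (frame i) =
      ∫ x, fderiv ℝ (fun y => divergence α y u) x v * η x := by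
    simp_rw [integral_mul_fderiv_test hV (hαc u _) (hηd v) (hc.fderiv_apply ℝ v) (hηs v)]
    rw [Finset.sum_neg_distrib, ← integral_finsetSum _ fun i _ => hdiv i u v,
      neg_eq_iff_eq_neg, ← integral_mul_fderiv_test hV (hω u) hη hc hηV]
    refine integral_congr_ae (Eventually.of_forall fun x => ?_)
    by_cases hx : x ∈ V
    · simp only [divergence, sum_apply, fderiv_apply_apply (hαd x hx),
        Finset.sum_mul]
      simp_rw [hsymm _ u]
    · simp [hout1 _ x hx]
  calc _ = ∫ x, ∑ i : Fin 3,
        ((1 / 2) * (fderiv ℝ (fun y => α y (frame i) (frame i)) x (frame b) *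
            fderiv ℝ η x (frame a) - fderiv ℝ (fun y => α y (frame i) (frame i)) x (frame a) *
            fderiv ℝ η x (frame b)) +
          (α x (frame b) (frame i) * fderiv ℝ (fun y => fderiv ℝ η y (frame a)) x (frame i) -
            α x (frame a) (frame i) *
              fderiv ℝ (fun y => fderiv ℝ η y (frame b)) x (frame i))) := by
        refine integral_congr_ae (Eventually.of_forall fun x => Finset.sum_congr rfl fun i _ => ?_)
        rw [hXd]
        -- Off `V` the tensor need not be differentiable, but there its derivatives are multiplied
        -- by first derivatives of `η`, which vanish.
        by_cases hx : x ∈ V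
        · rw [← fderiv_apply_apply (hαd x hx), ← fderiv_apply_apply (hαd x hx), hamField]
          simp
          ring
        · simp [hamField, hout1 _ x hx]
          ring
    _ = ∑ i : Fin 3, (∫ x, α x (frame b) (frame i) *
          fderiv ℝ (fun y => fderiv ℝ η y (frame a)) x (frame i)) -
        ∑ i : Fin 3, (∫ x, α x (frame a) (frame i) *
          fderiv ℝ (fun y => fderiv ℝ η y (frame b)) x (frame i)) := by
        exact integral_sum_sub_add_sub (fun i => htr i _ _) (fun i => htr i _ _)
          (fun i => hst i _ _) (fun i => hst i _ _)
          fun i => integral_fderiv_mul_fderiv_comm hV (hαc _ _) hη hc hηV (frame b) (frame a)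
    _ = _ := by
        rw [hpart, hpart, ← integral_sub (hint _ _) (hint _ _)]
        refine integral_congr_ae (Eventually.of_forall fun x => ?_)
        by_cases hx : x ∈ V
        · have hd : DifferentiableAt ℝ (divergence α) x :=
            ((contDiffOn_divergence hV hα).contDiffAt (hV.mem_nhds hx)).differentiableAt (by simp)
          have h1 (u v : E3) : fderiv ℝ (fun y => divergence α y u) x v =
              fderiv ℝ (divergence α) x v u := by
            rw [(hd.hasFDerivAt.clm_apply (hasFDerivAt_const u x)).fderiv]
            simp
          simp only [h1]
          ring
        · simp [hout x hx]

end Skyrme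

/-! ### Differentiation under the integral, and pullback metrics -/

namespace Skyrme


theorem hasDerivAt_setIntegral_of_contDiffOn {Ω : Set (ℝ × E3)} (hΩ : IsOpen Ω) {e : ℝ × E3 → ℝ}
    (he : ContDiffOn ℝ ∞ e Ω) {K : Set E3} (hK : IsCompact K) (hKΩ : Icc (-1) 1 ×ˢ K ⊆ Ω) :
    HasDerivAt (fun t => ∫ x in K, e (t, x)) (∫ x in K, fderiv ℝ e (0, x) (1, 0)) 0 := by
  have hcomp : IsCompact (Icc (-1 : ℝ) 1 ×ˢ K) := isCompact_Icc.prod hK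
  have hd : ContinuousOn (fun p => fderiv ℝ e p (1, 0)) Ω :=
    (he.continuousOn_fderiv_of_isOpen hΩ (by simp)).clm_apply continuousOn_const
  obtain ⟨C, hC⟩ := hcomp.exists_bound_of_continuousOn (hd.mono hKΩ)
  have hslice {g : ℝ × E3 → ℝ} (hg : ContinuousOn g Ω) {t : ℝ} (ht : t ∈ Icc (-1 : ℝ) 1) :
      ContinuousOn (fun x => g (t, x)) K :=
    hg.comp (by fun_prop) fun x hx => hKΩ ⟨ht, hx⟩
  have hnhds : Icc (-1 : ℝ) 1 ∈ 𝓝 (0 : ℝ) := Icc_mem_nhds (by norm_num) (by norm_num)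
  have h0 : (0 : ℝ) ∈ Icc (-1 : ℝ) 1 := mem_of_mem_nhds hnhds
  refine (hasDerivAt_integral_of_dominated_loc_of_deriv_le (F := fun t x => e (t, x))
    (F' := fun t x => fderiv ℝ e (t, x) (1, 0)) (bound := fun _ => C) hnhds ?_
    ((hslice he.continuousOn h0).integrableOn_compact hK)
    ((hslice hd h0).aestronglyMeasurable hK.measurableSet) ?_
    (integrableOn_const hK.measure_lt_top.ne) ?_).2
  · filter_upwards [hnhds] with t ht
    exact (hslice he.continuousOn ht).aestronglyMeasurable hK.measurableSet
  · exact ae_restrict_of_forall_mem hK.measurableSet fun x hx t ht => hC (t, x) ⟨ht, hx⟩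
  · refine ae_restrict_of_forall_mem hK.measurableSet fun x hx t ht => ?_
    have h1 : HasFDerivAt e (fderiv ℝ e (t, x)) (t, x) :=
      ((he.contDiffAt (hΩ.mem_nhds (hKΩ ⟨ht, hx⟩))).differentiableAt (by simp)).hasFDerivAt
    exact h1.comp_hasDerivAt t ((hasDerivAt_id t).prodMk (hasDerivAt_const t x))

theorem pullbackMetric_apply (φ : E3 → S3) (x u v : E3) :
    pullbackMetric φ x u v =
      inner ℝ (fderiv ℝ (fun y => (φ y : E4)) x u) (fderiv ℝ (fun y => (φ y : E4)) x v) := rfl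

theorem pullbackMetric_comm (φ : E3 → S3) (x u v : E3) :
    pullbackMetric φ x u v = pullbackMetric φ x v u := by
  rw [pullbackMetric_apply, pullbackMetric_apply, real_inner_comm]

theorem pullbackMetric_self_nonneg (φ : E3 → S3) (x u : E3) : 0 ≤ pullbackMetric φ x u u := by
  rw [pullbackMetric_apply]
  exact real_inner_self_nonneg

theorem contDiffOn_pullbackMetric {φ : E3 → S3} {V : Set E3} (hV : IsOpen V)
    (hφ : ContDiffOn ℝ ∞ (fun y => (φ y : E4)) V) : ContDiffOn ℝ ∞ (pullbackMetric φ) V := by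
  refine contDiffOn_clm_apply.2 fun u => contDiffOn_clm_apply.2 fun v => ?_
  simp_rw [pullbackMetric_apply]
  have h := hφ.fderiv_of_isOpen hV (m := ∞) (by simp)
  exact (h.clm_apply contDiffOn_const).inner ℝ (h.clm_apply contDiffOn_const)

theorem pullbackMetric_comp {φ : E3 → S3} {ψ : E3 → E3} {x : E3}
    (hφ : DifferentiableAt ℝ (fun y => (φ y : E4)) (ψ x)) (hψ : DifferentiableAt ℝ ψ x)
    (u v : E3) :
    pullbackMetric (φ ∘ ψ) x u v =
      pullbackMetric φ (ψ x) (fderiv ℝ ψ x u) (fderiv ℝ ψ x v) := by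
  have h : fderiv ℝ (fun y => ((φ ∘ ψ) y : E4)) x =
      (fderiv ℝ (fun y => (φ y : E4)) (ψ x)).comp (fderiv ℝ ψ x) := fderiv_comp x hφ hψ
  rw [pullbackMetric_apply, h]
  rfl

/-! ### Radial Hamiltonians, whose flows are twists -/

section Bump

/-- A smooth function positive exactly on the ball of radius `ε` about `c`. -/
noncomputable def radialBump (c : E3) (ε : ℝ) (x : E3) : ℝ := expNegInvGlue (ε ^ 2 - ‖x - c‖ ^ 2)

/-- The angular speed of the rotation generated by `radialBump`. -/
noncomputable def bumpSpeed (ε s : ℝ) : ℝ := 2 * deriv (fun r => expNegInvGlue (ε ^ 2 - r)) s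

variable {c : E3} {ε : ℝ} {a b : Fin 3}

theorem contDiff_radialBump : ContDiff ℝ ∞ (radialBump c ε) :=
  expNegInvGlue.contDiff.comp (contDiff_const.sub ((contDiff_id.sub contDiff_const).norm_sq ℝ))

theorem contDiff_expNegInvGlue_sub : ContDiff ℝ ∞ fun r => expNegInvGlue (ε ^ 2 - r) :=
  expNegInvGlue.contDiff.comp (contDiff_const.sub contDiff_id)

theorem contDiff_bumpSpeed : ContDiff ℝ ∞ (bumpSpeed ε) := by
  unfold bumpSpeed
  exact contDiff_const.mul (contDiff_infty_iff_deriv.1 contDiff_expNegInvGlue_sub).2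

/-- A nonnegative function has zero derivative where it vanishes; this covers the boundary value `s
= ε²` as well. -/
theorem bumpSpeed_eq_zero {s : ℝ} (hs : ε ^ 2 ≤ s) : bumpSpeed ε s = 0 := by
  have hmin : IsLocalMin (fun r => expNegInvGlue (ε ^ 2 - r)) s := by
    refine Eventually.of_forall fun r => ?_
    simp only
    rw [expNegInvGlue.zero_of_nonpos (sub_nonpos.2 hs)]
    exact expNegInvGlue.nonneg _
  rw [bumpSpeed, hmin.deriv_eq_zero, mul_zero]

theorem radialBump_nonneg (x : E3) : 0 ≤ radialBump c ε x := expNegInvGlue.nonneg _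

theorem tsupport_radialBump (hε : 0 ≤ ε) :
    tsupport (radialBump c ε) ⊆ Metric.closedBall c ε := by
  refine closure_minimal (fun x hx => ?_) Metric.isClosed_closedBall
  by_contra h
  rw [mem_closedBall_iff_norm, not_le] at h
  exact hx (expNegInvGlue.zero_of_nonpos (sub_nonpos.2 (pow_le_pow_left₀ hε h.le 2)))

/-- The gradient of a function of `|x - c|²` is a multiple of `x - c`; turning its `(a, b)` part by
a right angle gives an infinitesimal rotation. This identifies the velocity of the twist with a
Hamiltonian field. -/
theorem hamField_radialBump (x : E3) :
    hamField (radialBump c ε) a b x = bumpSpeed ε (‖x - c‖ ^ 2) • rotGen a b (x - c) := by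
  have h1 : HasFDerivAt (fun y : E3 => y - c) (ContinuousLinearMap.id ℝ E3) x :=
    (hasFDerivAt_id x).sub_const c
  have h3 : HasFDerivAt (fun y : E3 => ‖y - c‖ ^ 2) (2 • (innerSL ℝ (x - c))) x := by
    simpa using h1.norm_sq
  have h4 := ((contDiff_expNegInvGlue_sub (ε := ε)).differentiable
    (by simp)).differentiableAt.hasDerivAt (x := ‖x - c‖ ^ 2)
  have h5 : HasFDerivAt (radialBump c ε) _ x :=
    HasDerivAt.comp_hasFDerivAt (h₂ := fun r => expNegInvGlue (ε ^ 2 - r)) x h4 h3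
  simp only [hamField, h5.fderiv, rotGen, bumpSpeed, frame]
  simp [EuclideanSpace.inner_single_right]
  module

theorem hasDerivAt_twist_zero (x : E3) :
    HasDerivAt (fun t => twist c a b (bumpSpeed ε) t x) (hamField (radialBump c ε) a b x) 0 := by
  rw [hamField_radialBump]
  unfold twist
  have h : HasDerivAt (fun t : ℝ => t * bumpSpeed ε (‖x - c‖ ^ 2)) (bumpSpeed ε (‖x - c‖ ^ 2)) 0 := by
    simpa using (hasDerivAt_id (0 : ℝ)).mul_const (bumpSpeed ε (‖x - c‖ ^ 2))
  have h2 := (((h.cos.sub_const 1).smul_const (planeProj a b (x - c))).const_add x).add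
    (h.sin.smul_const (rotGen a b (x - c)))
  refine h2.congr_deriv ?_
  simp

/-- Differentiating the explicit spatial derivative of the twist in `t` replaces an interchange of
mixed partial derivatives. -/
theorem hasDerivAt_fderiv_twist_zero (x u : E3) :
    HasDerivAt (fun t => fderiv ℝ (twist c a b (bumpSpeed ε) t) x u)
      (fderiv ℝ (hamField (radialBump c ε) a b) x u) 0 := by
  have hX : HasFDerivAt (hamField (radialBump c ε) a b)
      (bumpSpeed ε (‖x - c‖ ^ 2) • rotGen a b + (innerSL ℝ (x - c)).smulRight
        ((2 * deriv (bumpSpeed ε) (‖x - c‖ ^ 2)) • rotGen a b (x - c))) x := by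
    have h1 : HasFDerivAt (fun y : E3 => y - c) (ContinuousLinearMap.id ℝ E3) x :=
      (hasFDerivAt_id x).sub_const c
    have h3 : HasFDerivAt (fun y : E3 => ‖y - c‖ ^ 2) (2 • (innerSL ℝ (x - c))) x := by
      simpa using h1.norm_sq
    have h4 := ((contDiff_bumpSpeed (ε := ε)).differentiable
      (by simp)).differentiableAt.hasDerivAt (x := ‖x - c‖ ^ 2)
    rw [funext hamField_radialBump]
    refine ((h4.comp_hasFDerivAt x h3).smul ((rotGen a b).hasFDerivAt.comp x h1)).congr_fderiv ?_
    ext v : 1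
    simp
    module
  simp_rw [(hasFDerivAt_twist contDiff_bumpSpeed _ x).fderiv, hX.fderiv]
  generalize bumpSpeed ε (‖x - c‖ ^ 2) = s
  generalize deriv (bumpSpeed ε) (‖x - c‖ ^ 2) = d
  clear hX
  generalize x - c = y
  have h : HasDerivAt (fun t : ℝ => t * s) s 0 := by
    simpa using (hasDerivAt_id (0 : ℝ)).mul_const s
  have hl : HasDerivAt (fun t : ℝ => 2 * t * d) (2 * d) 0 := by
    simpa using ((hasDerivAt_id (0 : ℝ)).const_mul 2).mul_const d
  have h2 := ((((h.cos.sub_const 1).smul_const (planeProj a b u)).const_add u).add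
    (h.sin.smul_const (rotGen a b u))).add
      (((hl.smul ((h.cos.smul_const (rotGen a b y)).sub
        (h.sin.smul_const (planeProj a b y)))).const_smul (inner ℝ y u)))
  refine (h2.congr_deriv ?_).congr_of_eventuallyEq (Eventually.of_forall fun t => ?_)
  · simp
  · simp

end Bump

end Skyrme

/-! ### From a divergence that is not closed to an energy decreasing curve -/

namespace Skyrme


theorem extDerivOneForm_apply {ν : OneForm} {x : E3} (h : DifferentiableAt ℝ ν x)
    (v : Fin (1 + 1) → E3) :
    extDerivOneForm ν x v = fderiv ℝ ν x (v 0) (v 1) - fderiv ℝ ν x (v 1) (v 0) := by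
  have hd : DifferentiableAt ℝ
      (fun x => ContinuousAlternatingMap.ofSubsingleton ℝ E3 ℝ (0 : Fin 1) (ν x)) x :=
    (ContinuousAlternatingMap.ofSubsingletonLIE (𝕜 := ℝ) (E := E3) (F := ℝ) (0 : Fin 1)).differentiableAt.comp x h
  have h1 (w : E3) : fderiv ℝ (fun y => ν y w) x = (fderiv ℝ ν x).flip w := by
    have := h.hasFDerivAt.clm_apply (hasFDerivAt_const w x)
    rw [this.fderiv]
    ext
    simp
  rw [extDerivOneForm, extDeriv_apply hd]
  simp [Fin.sum_univ_two, h1, Fin.removeNth]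
  ring

/-- The antisymmetric part of `β` has a nonzero entry in the frame, and exchanging `a` and `b` flips
its sign, so the sign can be prescribed. -/
theorem exists_frame_of_bilin_ne {β : E3 →L[ℝ] E3 →L[ℝ] ℝ} {u v : E3} (h : β u v - β v u ≠ 0) :
    ∃ a b : Fin 3, a ≠ b ∧ β (frame a) (frame b) - β (frame b) (frame a) < 0 := by
  by_contra! hall
  have hsymm (a b : Fin 3) : β (frame a) (frame b) = β (frame b) (frame a) := by
    rcases eq_or_ne a b with rfl | hab
    · rfl
    · linarith [hall a b hab, hall b a hab.symm]
  have hexp (w : E3) : w = ∑ i, w i • frame i := by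
    ext j
    fin_cases j <;> simp [Fin.sum_univ_three, frame]
  refine h (sub_eq_zero.2 ?_)
  rw [hexp u, hexp v]
  simp only [map_sum, map_smul, sum_apply, smul_apply, smul_eq_mul]
  simp_rw [Finset.mul_sum]
  rw [Finset.sum_comm]
  refine Finset.sum_congr rfl fun i _ => Finset.sum_congr rfl fun j _ => ?_
  rw [hsymm]
  ring

/-- Finite energy fields whose stress tensor has a divergence that is not closed can be deformed by
volume preserving diffeomorphisms so that the energy decreases to first order. -/
theorem exists_curve_energy_decreasing {φ : E3 → S3} {V : Set E3} (hV : IsOpen V)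
    (hφ : ContDiffOn ℝ ∞ (fun y => (φ y : E4)) V) (hE : dirichletEnergy univ φ ≠ ⊤)
    (hncl : ¬ IsClosedFormOn V (divergence (pullbackMetric φ))) :
    ∃ ψ : ℝ → E3 → E3, IsSDiffCurve V ψ ∧ (∀ t, dirichletEnergy univ (φ ∘ ψ t) ≠ ⊤) ∧
      ∃ c < 0, HasDerivAt (fun t => (dirichletEnergy univ (φ ∘ ψ t)).toReal) c 0 := by
  have hα := contDiffOn_pullbackMetric hV hφ
  set α := pullbackMetric φ with hαdef
  have hω := contDiffOn_divergence hV hα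
  have hαd : ∀ x ∈ V, DifferentiableAt ℝ α x := fun x hx =>
    (hα.contDiffAt (hV.mem_nhds hx)).differentiableAt (by simp)
  simp only [IsClosedFormOn, not_forall] at hncl
  obtain ⟨c, hcV, hc⟩ := hncl
  have hcd : DifferentiableAt ℝ (divergence α) c :=
    (hω.contDiffAt (hV.mem_nhds hcV)).differentiableAt (by simp)
  obtain ⟨w, hw⟩ : ∃ w, extDerivOneForm (divergence α) c w ≠ 0 := by
    by_contra! h
    exact hc (ContinuousAlternatingMap.ext h)
  rw [extDerivOneForm_apply hcd] at hw
  obtain ⟨a, b, hab, hneg⟩ := exists_frame_of_bilin_ne hw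
  let curl : E3 → ℝ := fun x => fderiv ℝ (divergence α) x (frame a) (frame b) -
    fderiv ℝ (divergence α) x (frame b) (frame a)
  have hcurl : ContinuousOn curl V := by
    have h := hω.continuousOn_fderiv_of_isOpen hV (by simp)
    exact ((h.clm_apply continuousOn_const).clm_apply continuousOn_const).sub
      ((h.clm_apply continuousOn_const).clm_apply continuousOn_const)
  -- By continuity the curl component stays negative on a whole closed ball, which will carry both
  -- the bump and the twist.
  obtain ⟨ε, hε, hball⟩ : ∃ ε > 0, Metric.closedBall c ε ⊆ V ∩ curl ⁻¹' Iio 0 :=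
    Metric.nhds_basis_closedBall.mem_iff.1
      ((hcurl.isOpen_inter_preimage hV isOpen_Iio).mem_nhds ⟨hcV, hneg⟩)
  set K := Metric.closedBall c ε with hKdef
  have hK : IsCompact K := isCompact_closedBall c ε
  have hKV : K ⊆ V := hball.trans inter_subset_left
  let ψ := twist c a b (bumpSpeed ε)
  let η := radialBump c ε
  have hχ0 : ∀ s, ε ^ 2 ≤ s → bumpSpeed ε s = 0 := fun s => bumpSpeed_eq_zero
  have hψ : ContDiff ℝ ∞ (fun p : ℝ × E3 => ψ p.1 p.2) := contDiff_twist contDiff_bumpSpeed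
  have hψK : ∀ t, ∀ x ∈ K, ψ t x ∈ K := fun t x hx => by
    rw [hKdef, mem_closedBall_iff_norm] at hx ⊢
    rwa [norm_twist_sub hab]
  have hψd (t : ℝ) : Differentiable ℝ (ψ t) := fun x =>
    (hasFDerivAt_twist contDiff_bumpSpeed t x).differentiableAt
  have hsupp : tsupport η ⊆ K := tsupport_radialBump hε.le
  have hηc : HasCompactSupport η := hK.of_isClosed_subset (isClosed_tsupport _) hsupp
  -- the energy density on `K`
  let e : ℝ × E3 → ℝ := fun p => (1 / 2) * ∑ i : Fin 3,
    α (ψ p.1 p.2) (fderiv ℝ (ψ p.1) p.2 (frame i)) (fderiv ℝ (ψ p.1) p.2 (frame i))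
  let Ω : Set (ℝ × E3) := (fun p : ℝ × E3 => ψ p.1 p.2) ⁻¹' V
  have hΩ : IsOpen Ω := hV.preimage hψ.continuous
  have hKΩ (t : ℝ) : ∀ x ∈ K, (t, x) ∈ Ω := fun x hx => hKV (hψK t x hx)
  have he : ContDiffOn ℝ ∞ e Ω := by
    have h1 : ContDiffOn ℝ ∞ (fun p : ℝ × E3 => α (ψ p.1 p.2)) Ω :=
      hα.comp hψ.contDiffOn fun p hp => hp
    have h2 : ContDiff ℝ ∞ (fun p : ℝ × E3 => fderiv ℝ (ψ p.1) p.2) := by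
      refine ContDiff.fderiv (m := ∞) (f := fun p : ℝ × E3 => ψ p.1) (g := Prod.snd) ?_
        contDiff_snd (by simp)
      exact hψ.comp ((contDiff_fst.comp contDiff_fst).prodMk contDiff_snd)
    have h3 (i : Fin 3) : ContDiffOn ℝ ∞ (fun p : ℝ × E3 => fderiv ℝ (ψ p.1) p.2 (frame i)) Ω :=
      (h2.clm_apply contDiff_const).contDiffOn
    exact contDiffOn_const.mul (ContDiffOn.sum fun i _ => (h1.clm_apply (h3 i)).clm_apply (h3 i))
  have hnn : ∀ p, 0 ≤ e p := fun p => mul_nonneg (by norm_num)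
    (Finset.sum_nonneg fun i _ => pullbackMetric_self_nonneg φ _ _)
  have hint (t : ℝ) : IntegrableOn (fun x => e (t, x)) K :=
    (he.continuousOn.comp (by fun_prop) (hKΩ t)).integrableOn_compact hK
  have hderiv := hasDerivAt_setIntegral_of_contDiffOn hΩ he hK fun p hp => hKΩ p.1 p.2 hp.2
  -- the energy is the integral over `K` and a constant
  let C : ℝ≥0∞ := ∫⁻ x in Kᶜ, ENNReal.ofReal ((1 / 2) * ∑ i : Fin 3, α x (frame i) (frame i))
  have hC : C ≠ ⊤ := by
    refine ne_top_of_le_ne_top hE ?_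
    rw [dirichletEnergy, Measure.restrict_univ]
    exact setLIntegral_le_lintegral _ _
  have hsplit (t : ℝ) : dirichletEnergy univ (φ ∘ ψ t) =
      ENNReal.ofReal (∫ x in K, e (t, x)) + C := by
    rw [dirichletEnergy, Measure.restrict_univ, ← lintegral_add_compl _ hK.measurableSet,
      ofReal_integral_eq_lintegral_ofReal (hint t) (Eventually.of_forall fun x => hnn _)]
    congr 1
    · refine setLIntegral_congr_fun hK.measurableSet fun x hx => ?_
      have hφd : DifferentiableAt ℝ (fun y => (φ y : E4)) (ψ t x) :=
        (hφ.contDiffAt (hV.mem_nhds (hKV (hψK t x hx)))).differentiableAt (by simp)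
      simp only [e, α, pullbackMetric_comp hφd (hψd t x)]
    -- The complement of the closed ball is open and the twist is the identity on it, so the
    -- differentials agree there even where `φ` is not smooth.
    · refine setLIntegral_congr_fun hK.measurableSet.compl fun x hx => ?_
      have hloc : (fun y => ((φ ∘ ψ t) y : E4)) =ᶠ[𝓝 x] fun y => (φ y : E4) := by
        filter_upwards [hK.isClosed.isOpen_compl.mem_nhds hx] with y hy
        have : ψ t y = y := twist_eq_self hε.le hχ0 t
          fun h => hy (Metric.ball_subset_closedBall h)
        simp [this]
      simp only [α, pullbackMetric_apply, hloc.fderiv_eq]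
  -- the first variation
  have hvar : ∀ x ∈ K, fderiv ℝ e (0, x) (1, 0) = ∑ i : Fin 3,
      ((1 / 2) * fderiv ℝ α x (hamField η a b x) (frame i) (frame i) +
        α x (fderiv ℝ (hamField η a b) x (frame i)) (frame i)) := fun x hx => by
    have he0 : HasFDerivAt e (fderiv ℝ e (0, x)) (0, x) :=
      ((he.contDiffAt (hΩ.mem_nhds (hKΩ 0 x hx))).differentiableAt (by simp)).hasFDerivAt
    have h1 : HasDerivAt (fun t => e (t, x)) (fderiv ℝ e (0, x) (1, 0)) 0 :=
      HasFDerivAt.comp_hasDerivAt (l := e) (f := fun t => (t, x)) (0 : ℝ) he0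
        ((hasDerivAt_id (0 : ℝ)).prodMk (hasDerivAt_const (0 : ℝ) x))
    have hψ0 : ψ 0 x = x := twist_zero x
    have h2 : HasDerivAt (fun t => α (ψ t x)) (fderiv ℝ α x (hamField η a b x)) 0 := by
      have h3 : HasFDerivAt α (fderiv ℝ α x) (ψ 0 x) := by
        rw [hψ0]
        exact (hαd x (hKV hx)).hasFDerivAt
      exact HasFDerivAt.comp_hasDerivAt (l := α) (f := fun t => ψ t x) (0 : ℝ) h3
        (hasDerivAt_twist_zero x)
    have hid : fderiv ℝ (ψ 0) x = ContinuousLinearMap.id ℝ E3 := by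
      rw [show ψ 0 = id from funext twist_zero, fderiv_id]
    have h4 (i : Fin 3) : HasDerivAt (fun t => fderiv ℝ (ψ t) x (frame i))
      (fderiv ℝ (hamField η a b) x (frame i)) 0 := hasDerivAt_fderiv_twist_zero x (frame i)
    have h5 : HasDerivAt (fun t => e (t, x)) _ 0 := (HasDerivAt.fun_sum fun i _ =>
      (h2.clm_apply (h4 i)).clm_apply (h4 i)).const_mul (1 / 2 : ℝ)
    rw [h1.unique h5, Finset.mul_sum]
    refine Finset.sum_congr rfl fun i _ => ?_
    have hsymm := pullbackMetric_comm φ x (frame i) (fderiv ℝ (hamField η a b) x (frame i))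
    simp only [hψ0, hid, ContinuousLinearMap.id_apply, add_apply, α, hsymm]
    ring
  have hηout : ∀ x ∉ K, η x = 0 := fun x hx =>
    image_eq_zero_of_notMem_tsupport fun h => hx (hsupp h)
  have hval : ∫ x in K, fderiv ℝ e (0, x) (1, 0) = ∫ x in K, curl x * η x := by
    have hXout : ∀ x ∉ K, hamField η a b =ᶠ[𝓝 x] fun _ => 0 := fun x hx => by
      filter_upwards [hK.isClosed.isOpen_compl.mem_nhds hx] with y hy
      have h (v : E3) : fderiv ℝ η y v = 0 := image_eq_zero_of_notMem_tsupport
        (f := fun x => fderiv ℝ η x v) fun h => hy (hsupp (tsupport_fderiv_apply_subset ℝ v h))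
      simp [hamField, h]
    rw [setIntegral_congr_fun hK.measurableSet hvar,
      setIntegral_eq_integral_of_forall_compl_eq_zero fun x hx => ?_,
      setIntegral_eq_integral_of_forall_compl_eq_zero fun x hx => ?_]
    · exact integral_variation_hamField hV hα (pullbackMetric_comm φ) contDiff_radialBump hηc
        (hsupp.trans hKV) a b
    · rw [hηout x hx, mul_zero]
    · simp [(hXout x hx).fderiv_eq, (hXout x hx).self_of_nhds]
  have hlt : ∫ x in K, curl x * η x < 0 := by
    have hcont : ContinuousOn (fun x => -(curl x * η x)) K :=
      ((hcurl.mono hKV).mul contDiff_radialBump.continuous.continuousOn).neg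
    have h0 : ∀ x ∈ K, 0 ≤ -(curl x * η x) := fun x hx =>
      neg_nonneg.2 (mul_nonpos_of_nonpos_of_nonneg (hball hx).2.le (radialBump_nonneg x))
    rw [← neg_pos, ← integral_neg]
    refine (setIntegral_pos_iff_support_of_nonneg_ae (ae_restrict_of_forall_mem hK.measurableSet h0)
      (hcont.integrableOn_compact hK)).2 ?_
    refine (Metric.measure_ball_pos volume c hε).trans_le (measure_mono ?_)
    intro x hx
    have hxK : x ∈ K := Metric.ball_subset_closedBall hx
    have hηx : 0 < η x := by
      rw [mem_ball_iff_norm] at hx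
      exact expNegInvGlue.pos_of_pos (sub_pos.2 (pow_lt_pow_left₀ hx (norm_nonneg _) two_ne_zero))
    exact ⟨neg_ne_zero.2 (mul_ne_zero (hball hxK).2.ne hηx.ne'), hxK⟩
  refine ⟨ψ, isSDiffCurve_twist hab contDiff_bumpSpeed hε.le hχ0 hKV,
    fun t => by rw [hsplit]; exact ENNReal.add_ne_top.2 ⟨ENNReal.ofReal_ne_top, hC⟩,
    _, hval.trans_lt hlt, ?_⟩
  have hfun : (fun t => (dirichletEnergy univ (φ ∘ ψ t)).toReal) =
      fun t => (∫ x in K, e (t, x)) + C.toReal := funext fun t => by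
    rw [hsplit, ENNReal.toReal_add ENNReal.ofReal_ne_top hC,
      ENNReal.toReal_ofReal (setIntegral_nonneg hK.measurableSet fun x _ => hnn _)]
  rw [hfun]
  exact hderiv.add_const _

end Skyrme

/-! ### Spherical coordinates off the axis -/

namespace Skyrme


/-- The square of the distance to the axis. -/
def axisDistSq (x : E3) : ℝ := (x 0) ^ 2 + (x 1) ^ 2

theorem isOpen_offAxis : IsOpen offAxis :=
  (isOpen_ne_fun (by fun_prop) continuous_const).union (isOpen_ne_fun (by fun_prop) continuous_const)

theorem axisDistSq_pos {x : E3} (hx : x ∈ offAxis) : 0 < axisDistSq x := by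
  unfold axisDistSq
  rcases hx with h | h <;> positivity

theorem norm_sq_eq (x : E3) : ‖x‖ ^ 2 = axisDistSq x + (x 2) ^ 2 := by
  simp [EuclideanSpace.real_norm_sq_eq, Fin.sum_univ_three, axisDistSq]

theorem norm_pos_of_mem_offAxis {x : E3} (hx : x ∈ offAxis) : 0 < ‖x‖ := by
  rw [norm_pos_iff]
  rintro rfl
  simp [offAxis] at hx

theorem cos_polarAngle (x : E3) : cos (polarAngle x) = x 2 / ‖x‖ := by
  have h : |x 2 / ‖x‖| ≤ 1 := by
    rw [abs_div, abs_norm]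
    exact div_le_one_of_le₀ (PiLp.norm_apply_le x 2) (norm_nonneg x)
  exact cos_arccos (abs_le.1 h).1 (abs_le.1 h).2

theorem sin_polarAngle {x : E3} (hx : x ∈ offAxis) :
    sin (polarAngle x) = √(axisDistSq x) / ‖x‖ := by
  have hr := norm_pos_of_mem_offAxis hx
  rw [polarAngle, sin_arccos, ← sqrt_sq hr.le, ← sqrt_div (axisDistSq_pos hx).le, sqrt_sq hr.le]
  congr 1
  have := norm_sq_eq x
  field_simp
  linarith

theorem contDiffAt_norm_of_mem_offAxis {x : E3} (hx : x ∈ offAxis) :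
    ContDiffAt ℝ ∞ (fun y : E3 => ‖y‖) x :=
  contDiffAt_norm ℝ (norm_pos_iff.1 (norm_pos_of_mem_offAxis hx))

theorem contDiffAt_polarAngle {x : E3} (hx : x ∈ offAxis) : ContDiffAt ℝ ∞ polarAngle x := by
  have hr := norm_pos_of_mem_offAxis hx
  have h : (x 2 / ‖x‖) ^ 2 < 1 := by
    have := norm_sq_eq x
    have := axisDistSq_pos hx
    rw [div_pow, div_lt_one (by positivity)]
    linarith
  have h' := abs_lt.1 ((sq_lt_one_iff_abs_lt_one _).1 h)
  refine ContDiffAt.comp x (contDiffAt_arccos h'.1.ne' h'.2.ne) ?_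
  exact (EuclideanSpace.proj (𝕜 := ℝ) (2 : Fin 3)).contDiff.contDiffAt.div
    (contDiffAt_norm_of_mem_offAxis hx) hr.ne'

theorem hasFDerivAt_norm {x : E3} (hx : x ∈ offAxis) :
    HasFDerivAt (fun y : E3 => ‖y‖) (formDr x) x :=
  ((contDiffAt_norm_of_mem_offAxis hx).differentiableAt (by simp)).hasFDerivAt

theorem hasFDerivAt_polarAngle {x : E3} (hx : x ∈ offAxis) :
    HasFDerivAt polarAngle (formDtheta x) x :=
  ((contDiffAt_polarAngle hx).differentiableAt (by simp)).hasFDerivAt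

theorem hasFDerivAt_coord (i : Fin 3) (x : E3) :
    HasFDerivAt (fun y : E3 => y i) (EuclideanSpace.proj i : E3 →L[ℝ] ℝ) x :=
  (EuclideanSpace.proj i : E3 →L[ℝ] ℝ).hasFDerivAt

theorem formDr_apply {x : E3} (hx : x ∈ offAxis) (u : E3) : formDr x u = inner ℝ x u / ‖x‖ := by
  have hr := norm_pos_of_mem_offAxis hx
  have h1 : HasFDerivAt (fun y : E3 => ‖y‖ ^ 2) _ x := (hasFDerivAt_norm hx).pow 2
  have h2 : HasFDerivAt (fun y : E3 => ‖y‖ ^ 2) (2 • (innerSL ℝ x)) x := by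
    simpa using (hasFDerivAt_id x).norm_sq
  have h3 := congrArg (fun L : E3 →L[ℝ] ℝ => L u) (h1.unique h2)
  simp at h3
  field_simp
  linarith

/-- Obtained by differentiating `cos θ = x₂ / r` in two ways and dividing by `-sin θ`. -/
theorem formDtheta_apply {x : E3} (hx : x ∈ offAxis) (u : E3) :
    formDtheta x u = (x 2 * inner ℝ x u / ‖x‖ ^ 2 - u 2) / √(axisDistSq x) := by
  have hr := norm_pos_of_mem_offAxis hx
  have hρ := sqrt_pos.2 (axisDistSq_pos hx)
  have h1 : HasFDerivAt (fun y => cos (polarAngle y)) _ x := (hasFDerivAt_polarAngle hx).cos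
  have hinv : HasFDerivAt (fun y : E3 => ‖y‖⁻¹) _ x :=
    (hasDerivAt_inv hr.ne').comp_hasFDerivAt x (hasFDerivAt_norm hx)
  have h2 : HasFDerivAt (fun y => cos (polarAngle y)) _ x :=
    ((hasFDerivAt_coord 2 x).mul hinv).congr_of_eventuallyEq
      (Eventually.of_forall fun y => by simp [cos_polarAngle, div_eq_mul_inv])
  have h3 := congrArg (fun L : E3 →L[ℝ] ℝ => L u) (h1.unique h2)
  simp [sin_polarAngle hx, formDr_apply hx] at h3
  field_simp at h3 ⊢
  linear_combination -h3

theorem formDphi_apply (x u : E3) :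
    formDphi x u = (x 0 * u 1 - x 1 * u 0) / axisDistSq x := by
  simp [formDphi, axisDistSq]
  ring

theorem inner_eq (x u : E3) : inner ℝ x u = x 0 * u 0 + x 1 * u 1 + x 2 * u 2 := by
  simp [PiLp.inner_apply, Fin.sum_univ_three]
  ring

/-- The Euclidean metric in spherical coordinates, solved for `dθ²`. -/
theorem formDtheta_mul {x : E3} (hx : x ∈ offAxis) (u v : E3) :
    formDtheta x u * formDtheta x v = (inner ℝ u v - inner ℝ x u * inner ℝ x v / ‖x‖ ^ 2 -
      (x 0 * u 1 - x 1 * u 0) * (x 0 * v 1 - x 1 * v 0) / axisDistSq x) / ‖x‖ ^ 2 := by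
  have hq := axisDistSq_pos hx
  have hr := norm_pos_of_mem_offAxis hx
  have hr2 : ‖x‖ ^ 2 ≠ 0 := by positivity
  rw [formDtheta_apply hx, formDtheta_apply hx, div_mul_div_comm, mul_self_sqrt hq.le]
  rw [norm_sq_eq] at hr2 ⊢
  have hq' := hq.ne'
  simp only [inner_eq]
  unfold axisDistSq at *
  field_simp
  ring

/-- A branch of the azimuthal angle that is smooth near `x`. -/
noncomputable def azimuthNear (x y : E3) : ℝ :=
  -- The quotient is near `1` for `y` near `x`, far from the branch cut of the logarithm.
  (Complex.log ((⟨y 0, y 1⟩ : ℂ) / ⟨x 0, x 1⟩)).im + azimuth x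

theorem complex_ne_zero {x : E3} (hx : x ∈ offAxis) : (⟨x 0, x 1⟩ : ℂ) ≠ 0 := by
  intro h
  rcases hx with h0 | h0
  · exact h0 (congrArg Complex.re h)
  · exact h0 (congrArg Complex.im h)

theorem exists_azimuthNear_eq {x y : E3} (hx : x ∈ offAxis) (hy : y ∈ offAxis) :
    ∃ k : ℤ, azimuthNear x y = azimuth y + k * (2 * π) := by
  have h := Complex.arg_mul_coe_angle (div_ne_zero (complex_ne_zero hy) (complex_ne_zero hx))
    (complex_ne_zero hx)
  rw [div_mul_cancel₀ _ (complex_ne_zero hx), ← Real.Angle.coe_add, eq_comm,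
    Real.Angle.angle_eq_iff_two_pi_dvd_sub] at h
  obtain ⟨k, hk⟩ := h
  refine ⟨k, ?_⟩
  rw [azimuthNear, Complex.log_im, azimuth, azimuth]
  linarith

/-- The branches differ by multiples of `2π`, and `B` is an integer; hence the field does not see
the branch cut. -/
theorem cos_azimuthNear {x y : E3} (hx : x ∈ offAxis) (hy : y ∈ offAxis) (B : ℕ) :
    cos (B * azimuthNear x y) = cos (B * azimuth y) := by
  obtain ⟨k, hk⟩ := exists_azimuthNear_eq hx hy
  rw [hk, show (B : ℝ) * (azimuth y + k * (2 * π)) = B * azimuth y + (B * k : ℤ) * (2 * π) by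
    push_cast; ring, cos_add_int_mul_two_pi]

theorem sin_azimuthNear {x y : E3} (hx : x ∈ offAxis) (hy : y ∈ offAxis) (B : ℕ) :
    sin (B * azimuthNear x y) = sin (B * azimuth y) := by
  obtain ⟨k, hk⟩ := exists_azimuthNear_eq hx hy
  rw [hk, show (B : ℝ) * (azimuth y + k * (2 * π)) = B * azimuth y + (B * k : ℤ) * (2 * π) by
    push_cast; ring, sin_add_int_mul_two_pi]

/-- The horizontal coordinates as a complex number. -/
noncomputable def horizontal : E3 →L[ℝ] ℂ :=
  (EuclideanSpace.proj 0 : E3 →L[ℝ] ℝ).smulRight (1 : ℂ) +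
    (EuclideanSpace.proj 1 : E3 →L[ℝ] ℝ).smulRight Complex.I

theorem horizontal_apply (x : E3) : horizontal x = ⟨x 0, x 1⟩ := by
  apply Complex.ext <;> simp [horizontal]

theorem contDiffAt_azimuthNear {x : E3} (hx : x ∈ offAxis) :
    ContDiffAt ℝ ∞ (azimuthNear x) x := by
  have h1 : ContDiffAt ℝ ∞ (fun y : E3 => horizontal y / ⟨x 0, x 1⟩) x :=
    horizontal.contDiff.contDiffAt.div_const _
  have h2 : ContDiffAt ℝ ∞ Complex.log (horizontal x / ⟨x 0, x 1⟩) := by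
    refine (Complex.contDiffAt_log ?_).restrict_scalars ℝ
    rw [horizontal_apply, div_self (complex_ne_zero hx)]
    simp
  have h3 := (Complex.imCLM.contDiff.contDiffAt.comp x (h2.comp x h1)).add
    (contDiffAt_const (c := azimuth x))
  refine h3.congr_of_eventuallyEq (Eventually.of_forall fun y => ?_)
  simp [azimuthNear, horizontal_apply]

theorem hasFDerivAt_azimuthNear {x : E3} (hx : x ∈ offAxis) :
    HasFDerivAt (azimuthNear x) (formDphi x) x := by
  have h1 : HasFDerivAt (fun y : E3 => (⟨x 0, x 1⟩ : ℂ)⁻¹ • horizontal y)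
      ((⟨x 0, x 1⟩ : ℂ)⁻¹ • horizontal) x := horizontal.hasFDerivAt.const_smul (⟨x 0, x 1⟩ : ℂ)⁻¹
  have h0 : (⟨x 0, x 1⟩ : ℂ)⁻¹ • horizontal x = 1 := by
    rw [horizontal_apply, smul_eq_mul, inv_mul_cancel₀ (complex_ne_zero hx)]
  have h2 : HasFDerivAt (fun y : E3 => Complex.log ((⟨x 0, x 1⟩ : ℂ)⁻¹ • horizontal y)) _ x :=
    ((Complex.hasStrictDerivAt_log (by rw [h0]; simp)).hasDerivAt.hasFDerivAt.restrictScalars ℝ).comp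
      x h1
  have h3 : HasFDerivAt (azimuthNear x) _ x :=
    ((Complex.imCLM.hasFDerivAt.comp x h2).add_const (azimuth x)).congr_of_eventuallyEq
      (Eventually.of_forall fun y => by
        simp [azimuthNear, horizontal_apply, div_eq_inv_mul])
  refine h3.congr_fderiv ?_
  ext u
  rw [formDphi_apply, h0]
  simp [horizontal_apply, Complex.inv_re, Complex.inv_im, Complex.normSq_apply, axisDistSq]
  ring

end Skyrme

/-! ### The suspension field: smoothness, pullback metric, divergence -/

namespace Skyrme


theorem polarAngle_normalize {x : E3} (hx : x ∈ offAxis) : polarAngle (‖x‖⁻¹ • x) = polarAngle x := by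
  have hr := norm_pos_of_mem_offAxis hx
  rw [polarAngle, polarAngle, norm_smul, norm_inv, norm_norm, inv_mul_cancel₀ hr.ne']
  simp
  ring_nf

theorem azimuth_normalize {x : E3} (hx : x ∈ offAxis) : azimuth (‖x‖⁻¹ • x) = azimuth x := by
  have hr := norm_pos_of_mem_offAxis hx
  rw [azimuth, azimuth, ← Complex.arg_real_mul ⟨x 0, x 1⟩ (inv_pos.2 hr)]
  congr 1
  apply Complex.ext <;> simp

/-- The field in the coordinates `(r, θ, ϕ)`, with a branch of `ϕ` that is smooth near `x`. -/
noncomputable def axialFieldNear (F : ℝ → ℝ) (B : ℕ) (x y : E3) : E4 :=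
  !₂[cos (F ‖y‖), sin (F ‖y‖) * (sin (polarAngle y) * cos (B * azimuthNear x y)),
    sin (F ‖y‖) * (sin (polarAngle y) * sin (B * azimuthNear x y)),
    sin (F ‖y‖) * cos (polarAngle y)]

variable {F : ℝ → ℝ} {B : ℕ} {x : E3}

theorem suspension_eventuallyEq (F : ℝ → ℝ) (B : ℕ) (hx : x ∈ offAxis) :
    (fun y => (suspension (angularMap B) F y : E4)) =ᶠ[𝓝 x] axialFieldNear F B x := by
  filter_upwards [isOpen_offAxis.mem_nhds hx] with y hy
  ext i
  fin_cases i <;> simp [suspension, angularMap, axialFieldNear, polarAngle_normalize hy,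
    azimuth_normalize hy, cos_azimuthNear hx hy, sin_azimuthNear hx hy]

theorem contDiffAt_axialFieldNear (hF : ContDiffOn ℝ ∞ F (Ioi 0)) (hx : x ∈ offAxis) :
    ContDiffAt ℝ ∞ (axialFieldNear F B x) x := by
  have hr := norm_pos_of_mem_offAxis hx
  have h1 : ContDiffAt ℝ ∞ (fun y : E3 => F ‖y‖) x :=
    (hF.contDiffAt (Ioi_mem_nhds hr)).comp x (contDiffAt_norm_of_mem_offAxis hx)
  have h2 := contDiffAt_polarAngle hx
  have h3 : ContDiffAt ℝ ∞ (fun y => (B : ℝ) * azimuthNear x y) x :=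
    contDiffAt_const.mul (contDiffAt_azimuthNear hx)
  rw [contDiffAt_euclidean]
  intro i
  fin_cases i
  · exact h1.cos
  · exact h1.sin.mul (h2.sin.mul h3.cos)
  · exact h1.sin.mul (h2.sin.mul h3.sin)
  · exact h1.sin.mul h2.cos

theorem contDiffOn_suspension (hF : ContDiffOn ℝ ∞ F (Ioi 0)) :
    ContDiffOn ℝ ∞ (fun y => (suspension (angularMap B) F y : E4)) offAxis := fun _ hx =>
  ((contDiffAt_axialFieldNear hF hx).congr_of_eventuallyEq
    (suspension_eventuallyEq F B hx)).contDiffWithinAt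

/-- Restricting the codomain to the sphere requires a map defined on a whole manifold, hence the
passage through the open submanifold. -/
theorem contMDiffOn_suspension (hF : ContDiffOn ℝ ∞ F (Ioi 0)) :
    ContMDiffOn 𝓘(ℝ, E3) (𝓡 3) ∞ (suspension (angularMap B) F) offAxis := by
  let U : TopologicalSpace.Opens E3 := ⟨offAxis, isOpen_offAxis⟩
  have h1 : ContMDiff 𝓘(ℝ, E3) 𝓘(ℝ, E4) ∞
      (fun y : U => (suspension (angularMap B) F y : E4)) := fun y =>
    contMDiffAt_subtype_iff (f := fun y => (suspension (angularMap B) F y : E4)).2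
      ((contDiffOn_suspension hF).contDiffAt (isOpen_offAxis.mem_nhds y.2)).contMDiffAt
  have h2 := h1.codRestrict_sphere (n := 3) fun y => (suspension (angularMap B) F y).2
  intro x hx
  exact (contMDiffAt_subtype_iff (U := U) (x := ⟨x, hx⟩)
    (f := suspension (angularMap B) F).1 (h2 ⟨x, hx⟩)).contMDiffWithinAt

theorem fderiv_apply_coord {Φ : E3 → E4} (h : DifferentiableAt ℝ Φ x) (u : E3) (i : Fin 4)
    {L : E3 →L[ℝ] ℝ} (hL : HasFDerivAt (fun y => Φ y i) L x) : fderiv ℝ Φ x u i = L u := by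
  have h1 : HasFDerivAt (fun y => Φ y i) ((EuclideanSpace.proj i : E4 →L[ℝ] ℝ).comp (fderiv ℝ Φ x))
    x := (EuclideanSpace.proj i : E4 →L[ℝ] ℝ).hasFDerivAt.comp x h.hasFDerivAt
  rw [← h1.unique hL]
  rfl

theorem pullbackMetric_suspension (hF : ContDiffOn ℝ ∞ F (Ioi 0)) (hx : x ∈ offAxis) (u v : E3) :
    pullbackMetric (suspension (angularMap B) F) x u v =
      (deriv F ‖x‖) ^ 2 * (formDr x u * formDr x v) +
        (sin (F ‖x‖)) ^ 2 * (formDtheta x u * formDtheta x v +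
          (B : ℝ) ^ 2 * (sin (polarAngle x)) ^ 2 * (formDphi x u * formDphi x v)) := by
  have hr := norm_pos_of_mem_offAxis hx
  have hFd : HasDerivAt F (deriv F ‖x‖) ‖x‖ :=
    ((hF.contDiffAt (Ioi_mem_nhds hr)).differentiableAt (by simp)).hasDerivAt
  have h1 : HasFDerivAt (fun y : E3 => F ‖y‖) (deriv F ‖x‖ • formDr x) x :=
    hFd.comp_hasFDerivAt x (hasFDerivAt_norm hx)
  have h2 := hasFDerivAt_polarAngle hx
  have h3 := (hasFDerivAt_azimuthNear hx).const_mul (B : ℝ)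
  have hd := (contDiffAt_axialFieldNear (B := B) hF hx).differentiableAt (by simp)
  have e0 (w : E3) := fderiv_apply_coord hd w 0 h1.cos
  have e1 (w : E3) := fderiv_apply_coord hd w 1 (h1.sin.mul (h2.sin.mul h3.cos))
  have e2 (w : E3) := fderiv_apply_coord hd w 2 (h1.sin.mul (h2.sin.mul h3.sin))
  have e3 (w : E3) := fderiv_apply_coord hd w 3 (h1.sin.mul h2.cos)
  rw [pullbackMetric_apply, (suspension_eventuallyEq F B hx).fderiv_eq, PiLp.inner_apply]
  simp only [Fin.sum_univ_four, e0, e1, e2, e3]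
  simp
  have hs := sin_sq_add_cos_sq (F ‖x‖)
  have ht := sin_sq_add_cos_sq (polarAngle x)
  have hb := sin_sq_add_cos_sq (B * azimuthNear x x)
  generalize sin (F ‖x‖) = s at *
  generalize cos (F ‖x‖) = c at *
  generalize sin (polarAngle x) = st at *
  generalize cos (polarAngle x) = ct at *
  generalize sin (B * azimuthNear x x) = sb at *
  generalize cos (B * azimuthNear x x) = cb at *
  generalize deriv F ‖x‖ = f at *
  generalize formDr x u = r1
  generalize formDr x v = r2
  generalize formDtheta x u = t1
  generalize formDtheta x v = t2
  generalize formDphi x u = p1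
  generalize formDphi x v = p2
  linear_combination ((c * f * st * r1 + s * ct * t1) * (c * f * st * r2 + s * ct * t2) +
    s ^ 2 * st ^ 2 * B ^ 2 * p1 * p2) * hb +
    (c ^ 2 * f ^ 2 * r1 * r2 + s ^ 2 * t1 * t2) * ht + f ^ 2 * r1 * r2 * hs

/-- The coefficient of the Euclidean metric in the pullback. -/
noncomputable def angularCoeff (F : ℝ → ℝ) (r : ℝ) : ℝ := (sin (F r)) ^ 2 / r ^ 2

/-- The coefficient of `r² dr²` in the pullback, beyond the conformal part. -/
noncomputable def radialCoeff (F : ℝ → ℝ) (r : ℝ) : ℝ :=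
  ((deriv F r) ^ 2 - angularCoeff F r) / r ^ 2

theorem contDiffOn_angularCoeff (hF : ContDiffOn ℝ ∞ F (Ioi 0)) :
    ContDiffOn ℝ ∞ (angularCoeff F) (Ioi 0) :=
  (hF.sin.pow 2).div (contDiffOn_id.pow 2) fun _ hr => pow_ne_zero 2 (ne_of_gt hr)

theorem contDiffOn_radialCoeff (hF : ContDiffOn ℝ ∞ F (Ioi 0)) :
    ContDiffOn ℝ ∞ (radialCoeff F) (Ioi 0) :=
  (((hF.deriv_of_isOpen isOpen_Ioi (by simp)).pow 2).sub (contDiffOn_angularCoeff hF)).div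
    (contDiffOn_id.pow 2) fun _ hr => pow_ne_zero 2 (ne_of_gt hr)

/-- Cartesian components turn the divergence into plain differentiation. The case `B = 1` is the
radially symmetric part; the rest is a multiple of `τ ⊗ τ / ρ²`. -/
theorem pullbackMetric_suspension_cartesian (hF : ContDiffOn ℝ ∞ F (Ioi 0)) (hx : x ∈ offAxis)
    (u v : E3) :
    pullbackMetric (suspension (angularMap B) F) x u v =
      radialCoeff F ‖x‖ * (inner ℝ x u * inner ℝ x v) + angularCoeff F ‖x‖ * inner ℝ u v +
        ((B : ℝ) ^ 2 - 1) * (angularCoeff F ‖x‖ *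
          ((x 0 * u 1 - x 1 * u 0) * (x 0 * v 1 - x 1 * v 0) * (axisDistSq x)⁻¹)) := by
  have hr := norm_pos_of_mem_offAxis hx
  have hq := axisDistSq_pos hx
  rw [pullbackMetric_suspension hF hx, formDtheta_mul hx, sin_polarAngle hx, div_pow,
    sq_sqrt hq.le, formDphi_apply, formDphi_apply, formDr_apply hx, formDr_apply hx, radialCoeff,
    angularCoeff]
  field_simp
  ring

theorem hasFDerivAt_radial {k : ℝ → ℝ} (hk : ContDiffOn ℝ ∞ k (Ioi 0)) (hx : x ∈ offAxis) :
    HasFDerivAt (fun y : E3 => k ‖y‖) (deriv k ‖x‖ • formDr x) x :=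
  (((hk.contDiffAt (Ioi_mem_nhds (norm_pos_of_mem_offAxis hx))).differentiableAt
    (by simp)).hasDerivAt).comp_hasFDerivAt x (hasFDerivAt_norm hx)

theorem hasFDerivAt_inv_axisDistSq (hx : x ∈ offAxis) :
    HasFDerivAt (fun y : E3 => (axisDistSq y)⁻¹)
      (-(axisDistSq x ^ 2)⁻¹ • ((2 * x 0) • (EuclideanSpace.proj 0 : E3 →L[ℝ] ℝ) +
        (2 * x 1) • (EuclideanSpace.proj 1 : E3 →L[ℝ] ℝ))) x := by
  have h : HasFDerivAt axisDistSq ((2 * x 0) • (EuclideanSpace.proj 0 : E3 →L[ℝ] ℝ) +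
      (2 * x 1) • (EuclideanSpace.proj 1 : E3 →L[ℝ] ℝ)) x := by
    refine (((hasFDerivAt_coord 0 x).pow 2).add ((hasFDerivAt_coord 1 x).pow 2)).congr_fderiv ?_
    simp
  exact (hasDerivAt_inv (axisDistSq_pos hx).ne').comp_hasFDerivAt x h

theorem fderiv_apply_apply_of_eqOn {α : Tensor2} (h : DifferentiableAt ℝ α x) (hx : x ∈ offAxis)
    (w : E3) {u v : E3} {g : E3 → ℝ} {L : E3 →L[ℝ] ℝ} (hg : HasFDerivAt g L x)
    (heq : ∀ y ∈ offAxis, α y u v = g y) : fderiv ℝ α x w u v = L w := by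
  have hE : (fun y => α y u v) =ᶠ[𝓝 x] g := by
    filter_upwards [isOpen_offAxis.mem_nhds hx] with y hy using heq y hy
  rw [fderiv_apply_apply h, hE.fderiv_eq, hg.fderiv]

/-- With `a` and `b` the radial and angular coefficients, `a x ⊗ x` contributes `(a' r + 4 a) x` and
`b g` contributes `(b' / r) x`. The rotation field is divergence free and annihilates `r` and `ρ`,
so the last term contributes only its centripetal acceleration, `-(x₀, x₁, 0)`, over `ρ²`. -/
theorem divergence_suspension_cartesian (hF : ContDiffOn ℝ ∞ F (Ioi 0)) (hx : x ∈ offAxis)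
    (v : E3) :
    divergence (pullbackMetric (suspension (angularMap B) F)) x v =
      (deriv (radialCoeff F) ‖x‖ * ‖x‖ + 4 * radialCoeff F ‖x‖ + deriv (angularCoeff F) ‖x‖ / ‖x‖) *
        inner ℝ x v -
      ((B : ℝ) ^ 2 - 1) * angularCoeff F ‖x‖ * ((x 0 * v 0 + x 1 * v 1) / axisDistSq x) := by
  have hr := norm_pos_of_mem_offAxis hx
  have hq := axisDistSq_pos hx
  have hαd : DifferentiableAt ℝ (pullbackMetric (suspension (angularMap B) F)) x :=
    ((contDiffOn_pullbackMetric isOpen_offAxis (contDiffOn_suspension hF)).contDiffAt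
      (isOpen_offAxis.mem_nhds hx)).differentiableAt (by simp)
  have hA := hasFDerivAt_radial (contDiffOn_radialCoeff hF) hx
  have hB := hasFDerivAt_radial (contDiffOn_angularCoeff hF) hx
  have hQ := hasFDerivAt_inv_axisDistSq hx
  have hc (i : Fin 3) := hasFDerivAt_coord i x
  have hin (w : E3) : HasFDerivAt (fun y : E3 => inner ℝ y w) (innerSL ℝ w) x := by
    simp_rw [real_inner_comm w]
    exact (innerSL ℝ w).hasFDerivAt
  have hτ (w : E3) := ((hc 0).mul_const (w 1)).sub ((hc 1).mul_const (w 0))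
  have key (i : Fin 3) := fderiv_apply_apply_of_eqOn hαd hx (frame i)
    (((hA.mul ((hin (frame i)).mul (hin v))).add (hB.mul_const (inner ℝ (frame i) v))).add
      ((hB.mul (((hτ (frame i)).mul (hτ v)).mul hQ)).const_mul ((B : ℝ) ^ 2 - 1)))
    (fun y hy => pullbackMetric_suspension_cartesian hF hy (frame i) v)
  have hdiv : divergence (pullbackMetric (suspension (angularMap B) F)) x v = ∑ i : Fin 3,
      fderiv ℝ (pullbackMetric (suspension (angularMap B) F)) x (frame i) (frame i) v := by
    simp [divergence]
  rw [hdiv, Finset.sum_congr rfl fun i _ => key i, Fin.sum_univ_three]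
  -- With `r` written as `|x|² / r`, the final identity holds for `r` an independent variable.
  have h2 : deriv (radialCoeff F) ‖x‖ * ‖x‖ =
      deriv (radialCoeff F) ‖x‖ * (((x 0) ^ 2 + (x 1) ^ 2 + (x 2) ^ 2) / ‖x‖) := by
    rw [← axisDistSq, ← norm_sq_eq]
    field_simp
  rw [h2]
  simp [formDr_apply hx, frame, EuclideanSpace.inner_single_right, EuclideanSpace.inner_single_left]
  rw [inner_eq x v]
  have hq' := hq.ne'
  clear key hdiv hQ hA hB hτ h2 hin hαd hc hq
  unfold axisDistSq at *
  generalize ‖x‖ = r at *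
  field_simp
  ring

end Skyrme

/-! ### Failure of closedness -/

namespace Skyrme


variable {F : ℝ → ℝ} {B : ℕ} {x : E3}

/-- This is `d log sin θ = d log ρ - dr / r`, since `sin θ = ρ / r`. -/
theorem cot_mul_formDtheta (hx : x ∈ offAxis) (v : E3) :
    Real.cot (polarAngle x) * formDtheta x v =
      (x 0 * v 0 + x 1 * v 1) / axisDistSq x - inner ℝ x v / ‖x‖ ^ 2 := by
  have hr := norm_pos_of_mem_offAxis hx
  have hq := axisDistSq_pos hx
  have hρ := sqrt_pos.2 hq
  have hr2 : ‖x‖ ^ 2 ≠ 0 := by positivity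
  have h1 : Real.cot (polarAngle x) = x 2 / √(axisDistSq x) := by
    rw [Real.cot_eq_cos_div_sin, cos_polarAngle, sin_polarAngle hx]
    field_simp
  rw [h1, formDtheta_apply hx, div_mul_div_comm, mul_self_sqrt hq.le, inner_eq]
  rw [norm_sq_eq] at hr2 ⊢
  have hq' := hq.ne'
  unfold axisDistSq at *
  field_simp
  ring

theorem divergence_suspension (hF : ContDiffOn ℝ ∞ F (Ioi 0)) (B : ℕ) :
    ∃ p : ℝ → ℝ, ContDiffOn ℝ ∞ p (Ioi 0) ∧ ∀ x ∈ offAxis,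
      divergence (pullbackMetric (suspension (angularMap B) F)) x =
        p ‖x‖ • formDr x - (((B : ℝ) ^ 2 - 1) * ((sin (F ‖x‖)) ^ 2 / ‖x‖ ^ 2) *
          Real.cot (polarAngle x)) • formDtheta x := by
  have ha := contDiffOn_radialCoeff hF
  have hb := contDiffOn_angularCoeff hF
  refine ⟨fun r => (deriv (radialCoeff F) r * r + 4 * radialCoeff F r) * r +
    deriv (angularCoeff F) r - ((B : ℝ) ^ 2 - 1) * angularCoeff F r / r, ?_, fun x hx => ?_⟩
  · have ha' := ha.deriv_of_isOpen (m := ∞) isOpen_Ioi (by simp)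
    have hb' := hb.deriv_of_isOpen (m := ∞) isOpen_Ioi (by simp)
    exact (((((ha'.mul contDiffOn_id).add (contDiffOn_const.mul ha)).mul contDiffOn_id).add
      hb').sub ((contDiffOn_const.mul hb).div contDiffOn_id fun r hr => ne_of_gt hr))
  · ext v
    have hr := norm_pos_of_mem_offAxis hx
    have h := cot_mul_formDtheta hx v
    rw [divergence_suspension_cartesian hF hx, ← angularCoeff]
    simp only [sub_apply, smul_apply, smul_eq_mul, mul_assoc, h, formDr_apply hx]
    field_simp
    ring

theorem fderiv_form_apply {ν : OneForm} {v : E3} {L : E3 →L[ℝ] ℝ} (h : DifferentiableAt ℝ ν x)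
    (hL : HasFDerivAt (fun y => ν y v) L x) (u : E3) : fderiv ℝ ν x u v = L u := by
  have h1 : HasFDerivAt (fun y => ν y v) _ x :=
    h.hasFDerivAt.clm_apply (hasFDerivAt_const v x)
  rw [hL.unique h1]
  simp

/-- A one-form `k₁(r) r dr + k₂(r) d log ρ`, with `ρ` the distance to the axis, is closed only if
`k₂` is locally constant. -/
theorem deriv_eq_zero_of_isClosedFormOn {ν : OneForm} {k₁ k₂ : ℝ → ℝ}
    (h₁ : ContDiffOn ℝ ∞ k₁ (Ioi 0)) (h₂ : ContDiffOn ℝ ∞ k₂ (Ioi 0))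
    (hν : ∀ x ∈ offAxis, ∀ v, ν x v =
      k₁ ‖x‖ * inner ℝ x v + k₂ ‖x‖ * ((x 0 * v 0 + x 1 * v 1) * (axisDistSq x)⁻¹))
    (hcl : IsClosedFormOn offAxis ν) {r : ℝ} (hr : 0 < r) : deriv k₂ r = 0 := by
  have hder (v x : E3) (hx : x ∈ offAxis) :=
    ((hasFDerivAt_radial h₁ hx).mul ((innerSL ℝ v).hasFDerivAt (x := x))).add
    ((hasFDerivAt_radial h₂ hx).mul ((((hasFDerivAt_coord 0 x).mul_const (v 0)).add
      ((hasFDerivAt_coord 1 x).mul_const (v 1))).mul (hasFDerivAt_inv_axisDistSq hx)))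
  have hloc (v x : E3) (hx : x ∈ offAxis) := (hder v x hx).congr_of_eventuallyEq
    (f₁ := fun y => ν y v) (by
      filter_upwards [isOpen_offAxis.mem_nhds hx] with y hy
      simp [hν y hy v, real_inner_comm])
  have hνd (x : E3) (hx : x ∈ offAxis) : DifferentiableAt ℝ ν x := by
    have h (v : E3) := (hloc v x hx).differentiableAt
    have : ν = fun y => ∑ i : Fin 3, ν y (frame i) • (EuclideanSpace.proj i : E3 →L[ℝ] ℝ) := by
      ext y w
      have hw : w = ∑ i, w i • frame i := by
        ext j
        fin_cases j <;> simp [Fin.sum_univ_three, frame]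
      conv_lhs => rw [hw]
      simp [mul_comm]
    rw [this]
    exact DifferentiableAt.fun_sum fun i _ => (h (frame i)).smul_const _
  set s : ℝ := r / √2 with hs
  have hs0 : 0 < s := by positivity
  -- At this point of norm `r`, `dr ∧ d log ρ` evaluated on `(e₂, e₀)` is `(s / r)(1 / s) ≠ 0`.
  let x : E3 := !₂[s, 0, s]
  have hx : x ∈ offAxis := Or.inl (by simpa [x] using hs0.ne')
  have hnorm : ‖x‖ = r := by
    rw [← sq_eq_sq₀ (norm_nonneg x) hr.le, norm_sq_eq]
    simp [x, axisDistSq, hs, div_pow]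
  have key := congrArg (fun L => L ![frame 2, frame 0]) (hcl x hx)
  have hcomp (u v : E3) := fderiv_form_apply (hνd x hx) (hloc v x hx) u
  simp only [extDerivOneForm_apply (hνd x hx), hcomp] at key
  simp [formDr_apply hx, frame, EuclideanSpace.inner_single_right, EuclideanSpace.inner_single_left, hnorm, x, axisDistSq]
    at key
  simpa [hs0.ne', hr.ne'] using key

theorem exists_sin_ne_zero {F : ℝ → ℝ} (hF : ContinuousOn F (Ici 0)) (hF0 : F 0 = π)
    (hFinf : Tendsto F atTop (𝓝 0)) : ∃ r > 0, sin (F r) ≠ 0 := by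
  obtain ⟨R, hR0, hR⟩ : ∃ R, 0 < R ∧ F R < π / 2 :=
    ((eventually_gt_atTop 0).and (hFinf.eventually_lt_const (by positivity))).exists
  have hmem : π / 2 ∈ Icc (F R) (F 0) := ⟨hR.le, by rw [hF0]; linarith [pi_pos]⟩
  obtain ⟨r, hr, hFr⟩ := intermediate_value_Icc' hR0.le (hF.mono Icc_subset_Ici_self) hmem
  refine ⟨r, lt_of_le_of_ne hr.1 ?_, by rw [hFr]; simp⟩
  rintro rfl
  linarith [pi_pos]

/-- Otherwise `sin² F / r²` is constant on `(0, ∞)`, and its limit at infinity forces that constant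
to be zero. -/
theorem exists_deriv_angularCoeff_ne_zero (hF : ContDiffOn ℝ ∞ F (Ici 0)) (hF0 : F 0 = π)
    (hFinf : Tendsto F atTop (𝓝 0)) : ∃ r > 0, deriv (angularCoeff F) r ≠ 0 := by
  by_contra! hall
  obtain ⟨r, hr, hsin⟩ := exists_sin_ne_zero hF.continuousOn hF0 hFinf
  have hb := contDiffOn_angularCoeff (hF.mono Ioi_subset_Ici_self)
  have hconst : ∀ t > 0, angularCoeff F t = angularCoeff F r := fun t ht =>
    isOpen_Ioi.is_const_of_deriv_eq_zero isPreconnected_Ioi (hb.differentiableOn (by simp))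
      (fun y hy => hall y hy) ht hr
  have hlim : Tendsto (angularCoeff F) atTop (𝓝 0) := by
    have h1 : Tendsto (fun t => (sin (F t)) ^ 2) atTop (𝓝 0) := by
      simpa using ((continuous_sin.tendsto 0).comp hFinf).pow 2
    exact h1.div_atTop (tendsto_pow_atTop two_ne_zero)
  have hzero : angularCoeff F r = 0 := by
    refine tendsto_nhds_unique (tendsto_const_nhds.congr' ?_) hlim
    filter_upwards [eventually_gt_atTop 0] with t ht using (hconst t ht).symm
  rw [angularCoeff, div_eq_zero_iff] at hzero
  rcases hzero with h | h
  · exact hsin (pow_eq_zero_iff two_ne_zero |>.1 h)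
  · exact hr.ne' (pow_eq_zero_iff two_ne_zero |>.1 h)

end Skyrme

/-! ### The null axis, and the theorem -/

namespace Skyrme


theorem volume_compl_offAxis : volume offAxisᶜ = 0 := by
  let L : E3 →ₗ[ℝ] ℝ := (EuclideanSpace.proj (𝕜 := ℝ) (0 : Fin 3)).toLinearMap
  have hL : LinearMap.ker L ≠ ⊤ := fun h => by
    have h1 : frame 0 ∈ LinearMap.ker L := h ▸ Submodule.mem_top
    simp [L, frame] at h1
  refine measure_mono_null (fun x hx => ?_) (Measure.addHaar_submodule volume (LinearMap.ker L) hL)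
  by_contra h
  exact hx (Or.inl fun h0 => h (by simpa [L] using h0))

theorem dirichletEnergy_offAxis (φ : E3 → S3) :
    dirichletEnergy offAxis φ = dirichletEnergy univ φ := by
  rw [dirichletEnergy, dirichletEnergy,
    Measure.restrict_congr_set (eventuallyEq_univ.2 (mem_ae_iff.2 volume_compl_offAxis))]

theorem IsSDiff.mono {U V : Set E3} {ψ : E3 → E3} (h : IsSDiff U ψ) (hUV : U ⊆ V) : IsSDiff V ψ :=
  ⟨h.diffeo, h.volumePreserving, h.compactSupport, h.support_subset.trans hUV⟩

theorem IsSDiffCurve.mono {U V : Set E3} {ψ : ℝ → E3 → E3} (h : IsSDiffCurve U ψ) (hUV : U ⊆ V) :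
    IsSDiffCurve V ψ :=
  ⟨fun t => (h.mem t).mono hUV, h.zero, h.smooth, fun T =>
    let ⟨K, hK, hKU, hfix⟩ := h.support T
    ⟨K, hK, hKU.trans hUV, hfix⟩⟩

theorem exists_lt_of_hasDerivAt_neg {g : ℝ → ℝ} {c : ℝ} (hc : c < 0) (hg : HasDerivAt g c 0) :
    ∃ t, g t < g 0 := by
  have h1 : ∀ᶠ t in 𝓝[>] (0 : ℝ), slope g 0 t < 0 :=
    ((hasDerivAt_iff_tendsto_slope.1 hg).eventually_lt_const hc).filter_mono
      (nhdsWithin_mono _ fun t ht => ne_of_gt ht)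
  obtain ⟨t, ht, ht0⟩ := (h1.and self_mem_nhdsWithin).exists
  refine ⟨t, ?_⟩
  rw [slope_def_field, sub_zero, div_neg_iff] at ht
  have ht0' : 0 < t := ht0
  rcases ht with h | h <;> linarith

section Profile

variable {f : ℝ → ℝ} {B : ℕ}

theorem scale_pos (hB : 1 < B) : 0 < (B : ℝ) ^ (-(1 / 3) : ℝ) :=
  rpow_pos_of_pos (by exact_mod_cast (zero_lt_one.trans hB)) _

theorem contDiffOn_scaledProfile (hf : ContDiffOn ℝ ∞ f (Ici 0)) (hB : 1 < B) :
    ContDiffOn ℝ ∞ (scaledProfile f B) (Ici 0) :=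
  hf.comp (contDiffOn_const.mul contDiffOn_id) fun _ hr => mul_nonneg (scale_pos hB).le hr

theorem tendsto_scaledProfile (hf : Tendsto f atTop (𝓝 0)) (hB : 1 < B) :
    Tendsto (scaledProfile f B) atTop (𝓝 0) :=
  hf.comp (tendsto_id.const_mul_atTop (scale_pos hB))

end Profile

end Skyrme

theorem mainTheorem9 (f : ℝ → ℝ) (hf : ContDiffOn ℝ ∞ f (Ici 0)) (hdecr : AntitoneOn f (Ici 0))
    (hf0 : f 0 = π) (hfinf : Tendsto f atTop (𝓝 0)) (B : ℕ) (hB : 1 < B) :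
    -- `φ_B` is smooth away from the `z`-axis
    ContMDiffOn 𝓘(ℝ, Skyrme.E3) (𝓡 3) ∞ (Skyrme.axialField f B) Skyrme.offAxis ∧
    -- `φ_B^*h = f_B'(r)² dr² + sin² f_B(r) (dθ² + B² sin²θ dϕ²)`
    (∀ x ∈ Skyrme.offAxis, ∀ u v : Skyrme.E3,
      Skyrme.pullbackMetric (Skyrme.axialField f B) x u v =
        (deriv (Skyrme.scaledProfile f B) ‖x‖) ^ 2 * (Skyrme.formDr x u * Skyrme.formDr x v) +
        (sin (Skyrme.scaledProfile f B ‖x‖)) ^ 2 *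
          (Skyrme.formDtheta x u * Skyrme.formDtheta x v +
            (B : ℝ) ^ 2 * (sin (Skyrme.polarAngle x)) ^ 2 *
              (Skyrme.formDphi x u * Skyrme.formDphi x v))) ∧
    -- `div φ_B^*h = p(r) dr - (B² - 1) sin² f_B(r) r⁻² cot θ dθ`
    (∃ p : ℝ → ℝ, ContDiffOn ℝ ∞ p (Ioi 0) ∧ ∀ x ∈ Skyrme.offAxis,
      Skyrme.divergence (Skyrme.pullbackMetric (Skyrme.axialField f B)) x =
        p ‖x‖ • Skyrme.formDr x -
          (((B : ℝ) ^ 2 - 1) * ((sin (Skyrme.scaledProfile f B ‖x‖)) ^ 2 / ‖x‖ ^ 2) *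
            Real.cot (Skyrme.polarAngle x)) • Skyrme.formDtheta x) ∧
    -- the angular term, and the whole divergence, are not closed
    ¬ Skyrme.IsClosedFormOn Skyrme.offAxis (fun x =>
        (((B : ℝ) ^ 2 - 1) * ((sin (Skyrme.scaledProfile f B ‖x‖)) ^ 2 / ‖x‖ ^ 2) *
          Real.cot (Skyrme.polarAngle x)) • Skyrme.formDtheta x) ∧
    ¬ Skyrme.IsClosedFormOn Skyrme.offAxis
        (Skyrme.divergence (Skyrme.pullbackMetric (Skyrme.axialField f B))) ∧
    -- `φ_B` is not restricted harmonic, neither on the complement of the axis nor on `ℝ³`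
    ¬ Skyrme.IsRestrictedHarmonicOn Skyrme.offAxis (Skyrme.axialField f B) ∧
    ¬ Skyrme.IsRestrictedHarmonicOn univ (Skyrme.axialField f B) ∧
    -- if `E₂(φ_B)` is finite, some curve through the identity in `SDiff` decreases `E₂` to first
    -- order, and there are fields in the `SDiff(ℝ³)` orbit of `φ_B` of lower energy
    (Skyrme.dirichletEnergy univ (Skyrme.axialField f B) ≠ ⊤ →
      (∃ ψ : ℝ → Skyrme.E3 → Skyrme.E3, Skyrme.IsSDiffCurve Skyrme.offAxis ψ ∧ ∃ c < 0,
        HasDerivAt (fun t => (Skyrme.dirichletEnergy univ (Skyrme.axialField f B ∘ ψ t)).toReal)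
          c 0) ∧
      (∃ ψ : Skyrme.E3 → Skyrme.E3, Skyrme.IsSDiff univ ψ ∧
        Skyrme.dirichletEnergy univ (Skyrme.axialField f B ∘ ψ) <
          Skyrme.dirichletEnergy univ (Skyrme.axialField f B))) := by
  set F := Skyrme.scaledProfile f B with hFdef
  have hF : ContDiffOn ℝ ∞ F (Ici 0) := Skyrme.contDiffOn_scaledProfile hf hB
  have hFpos : ContDiffOn ℝ ∞ F (Ioi 0) := hF.mono Ioi_subset_Ici_self
  have hF0 : F 0 = π := by simp [hFdef, Skyrme.scaledProfile, hf0]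
  have hFinf : Tendsto F atTop (𝓝 0) := Skyrme.tendsto_scaledProfile hfinf hB
  have hφ : Skyrme.axialField f B = Skyrme.suspension (Skyrme.angularMap B) F := rfl
  obtain ⟨r, hr, hderiv⟩ := Skyrme.exists_deriv_angularCoeff_ne_zero hF hF0 hFinf
  have hb := Skyrme.contDiffOn_angularCoeff hFpos
  have hB2 : (B : ℝ) ^ 2 - 1 ≠ 0 := by
    have : (1 : ℝ) < B := by exact_mod_cast hB
    nlinarith
  have hmulc {c : ℝ} (hc : c ≠ 0) : deriv (fun t => c * Skyrme.angularCoeff F t) r ≠ 0 := by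
    rw [deriv_const_mul_field]
    exact mul_ne_zero hc hderiv
  have hnot1 : ¬ Skyrme.IsClosedFormOn Skyrme.offAxis (fun x =>
      (((B : ℝ) ^ 2 - 1) * ((sin (F ‖x‖)) ^ 2 / ‖x‖ ^ 2) *
        Real.cot (Skyrme.polarAngle x)) • Skyrme.formDtheta x) := fun hcl => by
    refine hmulc hB2 (Skyrme.deriv_eq_zero_of_isClosedFormOn
      -- From `cot θ dθ = d log ρ - dr / r`; only the coefficient of `d log ρ` affects closedness.
      (k₁ := fun t => -(((B : ℝ) ^ 2 - 1) * Skyrme.angularCoeff F t / t ^ 2)) ?_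
      (contDiffOn_const.mul hb) (fun x hx v => ?_) hcl hr)
    · exact ((contDiffOn_const.mul hb).div (contDiffOn_id.pow 2)
        fun t ht => pow_ne_zero 2 (ne_of_gt ht)).neg
    · have h := Skyrme.cot_mul_formDtheta hx v
      simp only [smul_apply, smul_eq_mul, mul_assoc, h, Skyrme.angularCoeff]
      ring
  have hnot2 : ¬ Skyrme.IsClosedFormOn Skyrme.offAxis
      (Skyrme.divergence (Skyrme.pullbackMetric (Skyrme.axialField f B))) := fun hcl => by
    refine hmulc (neg_ne_zero.2 hB2) (Skyrme.deriv_eq_zero_of_isClosedFormOn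
      (k₁ := fun t => deriv (Skyrme.radialCoeff F) t * t + 4 * Skyrme.radialCoeff F t +
        deriv (Skyrme.angularCoeff F) t / t) ?_
      (contDiffOn_const.mul hb) (fun x hx v => ?_) hcl hr)
    · have ha := Skyrme.contDiffOn_radialCoeff hFpos
      have ha' := ha.deriv_of_isOpen (m := ∞) isOpen_Ioi (by simp)
      have hb' := hb.deriv_of_isOpen (m := ∞) isOpen_Ioi (by simp)
      exact ((ha'.mul contDiffOn_id).add (contDiffOn_const.mul ha)).add
        (hb'.div contDiffOn_id fun t ht => ne_of_gt ht)
    · rw [hφ, Skyrme.divergence_suspension_cartesian hFpos hx]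
      ring
  have hcurve (hE : Skyrme.dirichletEnergy univ (Skyrme.axialField f B) ≠ ⊤) :=
    Skyrme.exists_curve_energy_decreasing Skyrme.isOpen_offAxis
      (Skyrme.contDiffOn_suspension hFpos) hE hnot2
  refine ⟨Skyrme.contMDiffOn_suspension hFpos,
    fun x hx u v => Skyrme.pullbackMetric_suspension hFpos hx u v,
    Skyrme.divergence_suspension hFpos B, hnot1, hnot2, fun ⟨hE, hcrit⟩ => ?_,
    fun ⟨hE, hcrit⟩ => ?_, fun hE => ?_⟩
  · rw [Skyrme.dirichletEnergy_offAxis] at hE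
    obtain ⟨ψ, hψ, -, c, hc, hd⟩ := hcurve hE
    have h0 := hcrit ψ hψ
    simp only [Skyrme.dirichletEnergy_offAxis] at h0
    exact hc.ne (hd.unique h0)
  · obtain ⟨ψ, hψ, -, c, hc, hd⟩ := hcurve hE
    exact hc.ne (hd.unique (hcrit ψ (hψ.mono (subset_univ _))))
  · obtain ⟨ψ, hψ, hfin, c, hc, hd⟩ := hcurve hE
    refine ⟨⟨ψ, hψ, c, hc, hd⟩, ?_⟩
    obtain ⟨t, ht⟩ := Skyrme.exists_lt_of_hasDerivAt_neg hc hd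
    refine ⟨ψ t, (hψ.mem t).mono (subset_univ _), ?_⟩
    have h0 : ψ 0 = id := funext hψ.zero
    -- Finiteness at both times matters, since `toReal` sends `⊤` to `0`.
    have h1 := (ENNReal.toReal_lt_toReal (hfin t) (hfin 0)).1 ht
    rwa [h0, Function.comp_id] at h1
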